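/- Let $\psi(-q):=f(-q,-q^3)$, where $f(a,b)=\sum_{m=-\infty}^{\infty}a^{m(m+1)/2}b^{m(m-1)/2}$ is Ramanujan's general theta function, and define the integers $\overline{b}_5(n)$, $n\ge 0$, by $$\sum_{n=0}^{\infty}\overline{b}_5(n)q^n=\frac{\psi^5(-q^5)}{\psi(-q)}.$$ For a set $S$ of nonnegative integers let $\underline{d}(S)=\liminf_{N\to\infty}\frac{1}{N}\,\#\{n\in S: 1\le n\le N\}$ be its lower asymptotic density among the positive integers. Then $\overline{b}_5(n)$ is zero for at least $30\%$, positive for at least $52\%$, and negative for at least $10\%$ of the positive integers $n$, that is, $$\underline{d}(\{n:\overline{b}_5(n)=0\})\ge \tfrac{30}{100},\qquad \underline{d}(\{n:\overline{b}_5(n)>0\})\ge \tfrac{52}{100},\qquad \underline{d}(\{n:\overline{b}_5(n)<0\})\ge \tfrac{10}{100}.$$ -/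

import Mathlib

/-- Ramanujan's general theta function
`f(a, b) = ∑_{m ∈ ℤ} a ^ (m (m + 1) / 2) * b ^ (m (m - 1) / 2)`
for formal power series `a`, `b` over `ℤ`, summed coefficient by coefficient (every coefficient
is a finite sum when the constant coefficients of `a` and `b` vanish). Both exponents are
nonnegative integers for every `m : ℤ`. -/
noncomputable def ramanujanTheta (a b : PowerSeries ℤ) : PowerSeries ℤ :=
  PowerSeries.mk fun n => ∑ᶠ m : ℤ,
    PowerSeries.coeff n (a ^ (m * (m + 1) / 2).toNat * b ^ (m * (m - 1) / 2).toNat)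

/-- The power series `ψ(-q ^ k) = f(-q ^ k, -q ^ (3 k))` in the variable `q` (for `k ≥ 1`). -/
noncomputable def psiNeg (k : ℕ) : PowerSeries ℤ :=
  ramanujanTheta (-PowerSeries.X ^ k) (-PowerSeries.X ^ (3 * k))

/-- The total exponent of `q` in the `m`-th term of `ψ(-q ^ k)` is `k (2 m ^ 2 - m)`. -/
theorem psiNeg_term (k : ℕ) (m : ℤ) :
    (-PowerSeries.X ^ k : PowerSeries ℤ) ^ (m * (m + 1) / 2).toNat *
        (-PowerSeries.X ^ (3 * k)) ^ (m * (m - 1) / 2).toNat =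
      PowerSeries.C ((-1) ^ m.natAbs) * PowerSeries.X ^ (k * (2 * m ^ 2 - m).toNat) := by
  obtain ⟨u, hu⟩ : ∃ u : ℕ, m * (m + 1) / 2 = u := ⟨_, (Int.toNat_of_nonneg
    (Int.ediv_nonneg (by rcases le_or_gt 0 m with h | h <;> nlinarith) (by norm_num))).symm⟩
  obtain ⟨v, hv⟩ : ∃ v : ℕ, m * (m - 1) / 2 = v := ⟨_, (Int.toNat_of_nonneg
    (Int.ediv_nonneg (by rcases le_or_gt 1 m with h | h <;> nlinarith) (by norm_num))).symm⟩
  have hu2 : m * (m + 1) = 2 * u := by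
    rw [← hu, Int.mul_ediv_cancel' (Int.even_mul_succ_self m).two_dvd]
  have hv2 : m * (m - 1) = 2 * v := by
    rw [← hv, Int.mul_ediv_cancel' (Int.even_mul_pred_self m).two_dvd]
  have hw : (2 * m ^ 2 - m).toNat = u + 3 * v := by
    have : 2 * m ^ 2 - m = ((u + 3 * v : ℕ) : ℤ) := by push_cast; linarith
    rw [this, Int.toNat_natCast]
  have hsq : u + v = m.natAbs * m.natAbs := by
    zify; rw [abs_mul_abs_self]; linarith
  have hs : (-1 : PowerSeries ℤ) ^ u * (-1) ^ v = (-1) ^ m.natAbs := by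
    rw [← pow_add, hsq, pow_mul]
    rcases Nat.even_or_odd m.natAbs with h | h
    · simp [h.neg_one_pow]
    · simp [h.neg_one_pow]
  rw [hu, hv, hw, Int.toNat_natCast, Int.toNat_natCast, neg_pow, neg_pow (PowerSeries.X ^ (3 * k)),
    map_pow, map_neg, map_one, ← hs]
  ring

/-- Only finitely many terms contribute to each coefficient of `ψ(-q ^ k)`. -/
theorem psiNeg_finite_support (k : ℕ) (hk : 1 ≤ k) (n : ℕ) :
    (Function.support fun m : ℤ => PowerSeries.coeff n
      ((-PowerSeries.X ^ k : PowerSeries ℤ) ^ (m * (m + 1) / 2).toNat *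
        (-PowerSeries.X ^ (3 * k)) ^ (m * (m - 1) / 2).toNat)).Finite := by
  refine (Set.finite_Icc (-(n : ℤ)) n).subset fun m hm => ?_
  rw [Function.mem_support, psiNeg_term, PowerSeries.coeff_C_mul, PowerSeries.coeff_X_pow] at hm
  have h : n = k * (2 * m ^ 2 - m).toNat := by
    by_contra h
    simp [h] at hm
  have h1 : (2 * m ^ 2 - m).toNat ≤ n := by rw [h]; exact Nat.le_mul_of_pos_left _ hk
  have h2 : 2 * m ^ 2 - m ≤ n := Int.toNat_le.mp h1
  rw [Set.mem_Icc]
  constructor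
  · rcases le_or_gt 0 m with h0 | h0 <;> nlinarith
  · rcases le_or_gt 1 m with h0 | h0 <;> nlinarith

theorem constantCoeff_psiNeg (k : ℕ) (hk : 1 ≤ k) :
    PowerSeries.constantCoeff (psiNeg k) = 1 := by
  rw [← PowerSeries.coeff_zero_eq_constantCoeff_apply, psiNeg, ramanujanTheta, PowerSeries.coeff_mk,
    finsum_eq_single _ (0 : ℤ)]
  · simp
  · intro m hm
    rw [psiNeg_term, PowerSeries.coeff_C_mul, PowerSeries.coeff_X_pow, if_neg, mul_zero]
    have : 0 < 2 * m ^ 2 - m := by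
      rcases lt_or_gt_of_ne hm with h | h <;> nlinarith
    have : 0 < (2 * m ^ 2 - m).toNat := by omega
    have := Nat.mul_pos hk this
    omega

/-- The power series `ψ(-q) ^ (-1)`: the inverse of `ψ(-q)`, whose constant coefficient is `1`. -/
noncomputable def psiNegInv : PowerSeries ℤ :=
  PowerSeries.invOfUnit (psiNeg 1) 1

theorem psiNeg_mul_psiNegInv : psiNeg 1 * psiNegInv = 1 :=
  PowerSeries.mul_invOfUnit _ _ (by simpa using constantCoeff_psiNeg 1 le_rfl)

/-- `b̄₅(n)`: the coefficient of `q ^ n` in `ψ(-q ^ 5) ^ 5 / ψ(-q)`. -/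
noncomputable def bBar5 (n : ℕ) : ℤ :=
  PowerSeries.coeff n (psiNeg 5 ^ 5 * psiNegInv)

/-- The lower asymptotic density of a set `S` among the positive integers:
the limit inferior, as `N → ∞`, of the proportion of `n ∈ {1, …, N}` that lie in `S`. -/
noncomputable def lowerDensity (S : Set ℕ) : ℝ :=
  Filter.liminf (fun N : ℕ => ((S ∩ Set.Icc 1 N).ncard : ℝ) / (N : ℝ)) Filter.atTop

/-! Let `χ = chi5`, σ(n) = ∑ χ(d)(n/d) (`twistedSigma`) and σ'(n) = ∑ χ(n/d)(n/d) (`twistedSigma'`),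
summed over d ∣ n. The quotient is an Eisenstein series: 4q³ψ(q⁵)⁵/ψ(q) is the generating function
of `lambertCoeff`, a combination of σ and σ' at n and n/2. Replacing q by -q gives 4 b̄₅(n) = (-1)^n
`lambertCoeff` (n + 3) (`four_mul_bBar5`).

Signs follow from arithmetic. Put N = n + 3. Always σ(N) > 0, and σ'(N) = χ(N)σ(N) when 5 ∤ N, while
σ'(N) < σ(N) when 5 ∣ N. With the behaviour of σ at the prime 2, this fixes the sign of b̄₅(n) from
N mod 20 in every class except N ≡ 0: six classes give zero, eleven give positive values, two give
negative values.

For the Eisenstein identity, write E_k for the product of (1 - q^(kn)) over n ≥ 1. A difference of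
two values of the Weierstrass function is a quotient of theta values (`wpSum_sub_wpSum`). With nome
q⁵ at the points q, q² it gives ∑ σ(n)qⁿ = qE₅⁵/E₁; with nome q at primitive fifth roots of unity it
gives 1 - 5∑ σ'(n)qⁿ = E₁⁵/E₅. Two quadratic theta relations, from splitting the Gaussian integers
modulo 2 + i, show that the eta quotients involved are rational in one function t of level ten. The
required linear relation (`euler_relation_level_ten`) is then an identity of rational functions in
t. -/

open Filter Topology

/-! ### Infinite q-products -/

/-- The infinite product `∏ (1 - a q ^ n)` over `n ≥ 0`. -/
noncomputable def poch (a q : ℂ) : ℂ := ∏' n : ℕ, (1 - a * q ^ n)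

/-- Euler's product `∏ (1 - q ^ n)` over `n ≥ 1`. -/
noncomputable def euler (q : ℂ) : ℂ := poch q q

theorem summable_norm_mul_pow (a : ℂ) {q : ℂ} (hq : ‖q‖ < 1) :
    Summable fun n : ℕ => ‖-(a * q ^ n)‖ := by
  simpa using (summable_geometric_of_lt_one (norm_nonneg q) hq).mul_left ‖a‖

theorem multipliable_poch (a : ℂ) {q : ℂ} (hq : ‖q‖ < 1) :
    Multipliable fun n : ℕ => 1 - a * q ^ n := by
  simpa [sub_eq_add_neg] using multipliable_one_add_of_summable (summable_norm_mul_pow a hq)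

theorem tendsto_poch (a : ℂ) {q : ℂ} (hq : ‖q‖ < 1) :
    Tendsto (fun N => ∏ n ∈ Finset.range N, (1 - a * q ^ n)) atTop (𝓝 (poch a q)) :=
  (multipliable_poch a hq).hasProd.tendsto_prod_nat

theorem poch_ne_zero {a q : ℂ} (hq : ‖q‖ < 1) (h : ∀ n : ℕ, a * q ^ n ≠ 1) : poch a q ≠ 0 := by
  have := tprod_one_add_ne_zero_of_summable (f := fun n : ℕ => -(a * q ^ n))
    (fun n => by rw [← sub_eq_add_neg]; exact sub_ne_zero.2 (h n).symm) (summable_norm_mul_pow a hq)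
  simpa [poch, sub_eq_add_neg] using this

theorem poch_eq_mul (a : ℂ) {q : ℂ} (hq : ‖q‖ < 1) : poch a q = (1 - a) * poch (a * q) q := by
  have h1 := (tendsto_poch a hq).comp (tendsto_add_atTop_nat 1)
  have h2 := (tendsto_poch (a * q) hq).const_mul (1 - a)
  refine tendsto_nhds_unique h1 (h2.congr fun N => ?_)
  simp only [Function.comp]
  rw [Finset.prod_range_succ']
  simp [pow_succ', mul_assoc, mul_comm]

theorem poch_eq_prod_poch (a : ℂ) {q : ℂ} (hq : ‖q‖ < 1) {m : ℕ} (hm : 0 < m) :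
    poch a q = ∏ r ∈ Finset.range m, poch (a * q ^ r) (q ^ m) := by
  have hqm : ‖q ^ m‖ < 1 := by
    rw [norm_pow]; exact pow_lt_one₀ (norm_nonneg q) hq hm.ne'
  have h1 := (tendsto_poch a hq).comp (tendsto_id.const_mul_atTop' hm)
  have h2 := tendsto_finsetProd (Finset.range m) fun r _ => tendsto_poch (a * q ^ r) hqm
  refine tendsto_nhds_unique h1 (h2.congr fun N => ?_)
  simp only [Function.comp, id]
  rw [Finset.prod_comm]
  induction N with
  | zero => simp
  | succ N ih =>
    rw [Finset.prod_range_succ, ih, mul_add_one, Finset.prod_range_add]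
    congr 1
    refine Finset.prod_congr rfl fun r _ => ?_
    rw [mul_assoc, ← pow_mul, ← pow_add, add_comm]

theorem poch_mul_poch_neg (a : ℂ) {q : ℂ} (hq : ‖q‖ < 1) :
    poch a q * poch (-a) q = poch (a ^ 2) (q ^ 2) := by
  rw [poch, poch, ← (multipliable_poch a hq).tprod_mul (multipliable_poch (-a) hq), poch]
  refine tprod_congr fun n => ?_
  rw [← pow_mul, mul_comm 2 n, pow_mul]
  ring

theorem norm_pow_lt_one {q : ℂ} (hq : ‖q‖ < 1) {k : ℕ} (hk : k ≠ 0) : ‖q ^ k‖ < 1 := by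
  rw [norm_pow]; exact pow_lt_one₀ (norm_nonneg q) hq hk

theorem euler_ne_zero {q : ℂ} (hq : ‖q‖ < 1) : euler q ≠ 0 := by
  refine poch_ne_zero hq fun n h => ?_
  have := norm_pow_lt_one hq (Nat.succ_ne_zero n)
  rw [pow_succ', h] at this
  simp at this

/-! ### The theta series and the Jacobi triple product -/

/-- The general term of the theta series. -/
noncomputable def thetaTerm (q z : ℂ) (m : ℤ) : ℂ := (-1) ^ m * q ^ (m * (m - 1) / 2) * z ^ m

/-- The theta series `∑ (-1) ^ m q ^ (m (m - 1) / 2) z ^ m` over `m : ℤ`. -/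
noncomputable def theta (q z : ℂ) : ℂ := ∑' m : ℤ, thetaTerm q z m

theorem two_mul_triangle (m : ℤ) : 2 * (m * (m - 1) / 2) = m * (m - 1) :=
  Int.mul_ediv_cancel' (Int.even_mul_pred_self m).two_dvd

theorem triangle_add_one (m : ℤ) : (m + 1) * (m + 1 - 1) / 2 = m * (m - 1) / 2 + m := by
  have h1 := two_mul_triangle m
  have h2 := two_mul_triangle (m + 1)
  linarith

theorem thetaTerm_add_one {q z : ℂ} (hq : q ≠ 0) (hz : z ≠ 0) (m : ℤ) :
    thetaTerm q z (m + 1) = -(z * q ^ m) * thetaTerm q z m := by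
  rw [thetaTerm, thetaTerm, triangle_add_one, zpow_add₀ hq, zpow_add_one₀ hz,
    zpow_add_one₀ (by norm_num)]
  ring

theorem thetaTerm_neg {q : ℂ} (hq : q ≠ 0) (z : ℂ) (m : ℤ) :
    thetaTerm q z (-m) = thetaTerm q (q / z) m := by
  have h1 := two_mul_triangle m
  have h2 := two_mul_triangle (-m)
  have h3 : -m * (-m - 1) / 2 = m * (m - 1) / 2 + m := by linarith
  rw [thetaTerm, thetaTerm, h3, zpow_add₀ hq, div_zpow, zpow_neg, zpow_neg, ← inv_zpow]
  norm_num
  ring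

theorem thetaTerm_ne_zero {q z : ℂ} (hq : q ≠ 0) (hz : z ≠ 0) (m : ℤ) : thetaTerm q z m ≠ 0 := by
  have h1 : (-1 : ℂ) ^ m ≠ 0 := zpow_ne_zero _ (by norm_num)
  exact mul_ne_zero (mul_ne_zero h1 (zpow_ne_zero _ hq)) (zpow_ne_zero _ hz)

theorem summable_norm_thetaTerm_nat {q z : ℂ} (hq : q ≠ 0) (hq1 : ‖q‖ < 1) (hz : z ≠ 0) :
    Summable fun n : ℕ => ‖thetaTerm q z n‖ := by
  refine summable_of_ratio_test_tendsto_lt_one (l := 0) one_pos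
    (Eventually.of_forall fun n => norm_ne_zero_iff.2 (thetaTerm_ne_zero hq hz n)) ?_
  have h := (tendsto_pow_atTop_nhds_zero_of_lt_one (norm_nonneg q) hq1).const_mul ‖z‖
  rw [mul_zero] at h
  refine h.congr fun n => ?_
  rw [norm_norm, norm_norm, Nat.cast_add, Nat.cast_one, thetaTerm_add_one hq hz, norm_mul,
    mul_div_cancel_right₀ _ (norm_ne_zero_iff.2 (thetaTerm_ne_zero hq hz n))]
  simp

theorem summable_norm_thetaTerm {q z : ℂ} (hq : q ≠ 0) (hq1 : ‖q‖ < 1) (hz : z ≠ 0) :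
    Summable fun m : ℤ => ‖thetaTerm q z m‖ := by
  refine Summable.of_nat_of_neg (summable_norm_thetaTerm_nat hq hq1 hz) ?_
  simp_rw [thetaTerm_neg hq z]
  exact summable_norm_thetaTerm_nat hq hq1 (div_ne_zero hq hz)

theorem theta_div {q : ℂ} (hq : q ≠ 0) (z : ℂ) : theta q (q / z) = theta q z := by
  rw [theta, theta, ← (Equiv.neg ℤ).tsum_eq (thetaTerm q z)]
  exact tsum_congr fun m => (thetaTerm_neg hq z m).symm

theorem theta_mul {q z : ℂ} (hq : q ≠ 0) (hz : z ≠ 0) : theta q (q * z) = -(theta q z / z) := by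
  rw [theta, theta, ← (Equiv.addRight (1 : ℤ)).tsum_eq (thetaTerm q z), ← tsum_div_const,
    ← tsum_neg]
  refine tsum_congr fun m => ?_
  rw [Equiv.coe_addRight, thetaTerm_add_one hq hz, thetaTerm, thetaTerm, mul_zpow]
  field_simp

/-- The reciprocal of the finite product `∏ (1 - q ^ j)` over `1 ≤ j ≤ k`, zero for `k < 0`. -/
noncomputable def recipQFactorial (q : ℂ) (k : ℤ) : ℂ :=
  if 0 ≤ k then (∏ j ∈ Finset.range k.toNat, (1 - q * q ^ j))⁻¹ else 0

theorem one_sub_mul_pow_ne_zero {q : ℂ} (hq1 : ‖q‖ < 1) (j : ℕ) : 1 - q * q ^ j ≠ 0 := by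
  intro h
  have := norm_pow_lt_one hq1 (Nat.succ_ne_zero j)
  rw [pow_succ', ← sub_eq_zero.1 h] at this
  simp at this

/-- Because the reciprocal factorial is set to zero at negative indices, the recurrence also holds
at k = 0, where 1 - q⁰ vanishes. No boundary cases remain in the q-binomial recurrence below. -/
theorem recipQFactorial_sub_one {q : ℂ} (hq1 : ‖q‖ < 1) (k : ℤ) :
    recipQFactorial q (k - 1) = (1 - q ^ k) * recipQFactorial q k := by
  rcases lt_trichotomy k 0 with h | h | h
  · rw [recipQFactorial, recipQFactorial, if_neg (by omega), if_neg (by omega), mul_zero]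
  · subst h
    simp [recipQFactorial]
  · obtain ⟨n, rfl⟩ : ∃ n : ℕ, k = n + 1 := ⟨(k - 1).toNat, by omega⟩
    rw [recipQFactorial, recipQFactorial, if_pos (by omega), if_pos (by omega)]
    have h1 : ((n : ℤ) + 1 - 1).toNat = n := by omega
    have h2 : ((n : ℤ) + 1).toNat = n + 1 := by omega
    have h3 : q ^ ((n : ℤ) + 1) = q * q ^ n := by
      rw [← pow_succ']; exact_mod_cast rfl
    rw [h1, h2, Finset.prod_range_succ, h3]
    have := one_sub_mul_pow_ne_zero hq1 n
    field_simp

/-- The coefficients of the finite form of the Jacobi triple product. -/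
noncomputable def jacobiCoeff (q : ℂ) (n : ℕ) (m : ℤ) : ℂ :=
  (∏ j ∈ Finset.range (2 * n), (1 - q * q ^ j)) *
    (recipQFactorial q (n - m) * recipQFactorial q (n + m))

/-- The coefficient is the Gaussian binomial of 2n over n + m. This is the q-Pascal rule applied
twice, in the shape produced by multiplying the finite product by (1 - zqⁿ)(1 - qⁿ⁺¹/z). -/
theorem jacobiCoeff_succ {q : ℂ} (hq : q ≠ 0) (hq1 : ‖q‖ < 1) (n : ℕ) (m : ℤ) :
    jacobiCoeff q (n + 1) m = (1 + q ^ (2 * n + 1)) * jacobiCoeff q n m +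
      q ^ ((n : ℤ) - m + 1) * jacobiCoeff q n (m - 1) +
      q ^ ((n : ℤ) + m + 1) * jacobiCoeff q n (m + 1) := by
  have e1 : recipQFactorial q ((n : ℤ) - m) =
      (1 - q ^ ((n : ℤ) - m + 1)) * recipQFactorial q ((n : ℤ) - m + 1) := by
    rw [← recipQFactorial_sub_one hq1]; congr 1; ring
  have e2 : recipQFactorial q ((n : ℤ) + m) =
      (1 - q ^ ((n : ℤ) + m + 1)) * recipQFactorial q ((n : ℤ) + m + 1) := by
    rw [← recipQFactorial_sub_one hq1]; congr 1; ring
  have e3 : recipQFactorial q ((n : ℤ) - m - 1) =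
      (1 - q ^ ((n : ℤ) - m + 1) / q) * recipQFactorial q ((n : ℤ) - m) := by
    rw [recipQFactorial_sub_one hq1, zpow_add_one₀ hq, mul_div_cancel_right₀ _ hq]
  have e4 : recipQFactorial q ((n : ℤ) + m - 1) =
      (1 - q ^ ((n : ℤ) + m + 1) / q) * recipQFactorial q ((n : ℤ) + m) := by
    rw [recipQFactorial_sub_one hq1, zpow_add_one₀ hq, mul_div_cancel_right₀ _ hq]
  have hxy : q ^ ((n : ℤ) - m + 1) * q ^ ((n : ℤ) + m + 1) = q * q ^ (2 * n + 1) := by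
    rw [← zpow_add₀ hq, ← pow_succ', ← zpow_natCast]; congr 1; push_cast; ring
  simp only [jacobiCoeff]
  have a1 : ((n + 1 : ℕ) : ℤ) - m = (n : ℤ) - m + 1 := by push_cast; ring
  have a2 : ((n + 1 : ℕ) : ℤ) + m = (n : ℤ) + m + 1 := by push_cast; ring
  have a3 : (n : ℤ) - (m - 1) = (n : ℤ) - m + 1 := by ring
  have a4 : (n : ℤ) + (m - 1) = (n : ℤ) + m - 1 := by ring
  have a5 : (n : ℤ) - (m + 1) = (n : ℤ) - m - 1 := by ring
  have a6 : (n : ℤ) + (m + 1) = (n : ℤ) + m + 1 := by ring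
  rw [a1, a2, a3, a4, a5, a6, e3, e4, e1, e2, mul_add_one, Finset.prod_range_succ,
    Finset.prod_range_succ]
  -- Since xy = q^(2n+2), all remaining powers of q are rational in x, y and q.
  generalize q ^ ((n : ℤ) - m + 1) = x at *
  generalize q ^ ((n : ℤ) + m + 1) = y at *
  have hs : q * q ^ (2 * n) = x * y / q := by rw [hxy]; field_simp; ring
  have hs' : q ^ (2 * n + 1) = x * y / q := by rw [hxy]; field_simp
  rw [← hxy, hs, hs']
  field_simp
  ring

/-- This is the finite triple product. The sum over ℤ has finite support, but stating it as a
`HasSum` over ℤ prepares the passage to the limit. -/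
theorem hasSum_jacobiCoeff {q z : ℂ} (hq : q ≠ 0) (hq1 : ‖q‖ < 1) (hz : z ≠ 0) (n : ℕ) :
    HasSum (fun m : ℤ => thetaTerm q z m * jacobiCoeff q n m)
      ((∏ k ∈ Finset.range n, (1 - z * q ^ k)) * ∏ k ∈ Finset.range n, (1 - q / z * q ^ k)) := by
  induction n with
  | zero =>
    convert hasSum_ite_eq (0 : ℤ) (1 : ℂ) using 1
    · funext m
      split_ifs with h
      · subst h
        simp [thetaTerm, jacobiCoeff, recipQFactorial]
      · rcases lt_or_gt_of_ne h with h | h <;> simp [jacobiCoeff, recipQFactorial, h.not_ge]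
    · simp
  | succ n ih =>
    have h1 := (Equiv.subRight (1 : ℤ)).hasSum_iff.2 ih
    have h2 := (Equiv.addRight (1 : ℤ)).hasSum_iff.2 ih
    have h := ((ih.mul_left (1 + q ^ (2 * n + 1))).add (h1.mul_left (-(z * q ^ n)))).add
      (h2.mul_left (-(q / z * q ^ n)))
    have e1 : (fun m : ℤ => thetaTerm q z m * jacobiCoeff q (n + 1) m) = fun m =>
        (1 + q ^ (2 * n + 1)) * (thetaTerm q z m * jacobiCoeff q n m) +
        -(z * q ^ n) * (thetaTerm q z (m - 1) * jacobiCoeff q n (m - 1)) +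
        -(q / z * q ^ n) * (thetaTerm q z (m + 1) * jacobiCoeff q n (m + 1)) := by
      funext m
      have t1 : thetaTerm q z m = -(z * q ^ (m - 1)) * thetaTerm q z (m - 1) := by
        rw [← thetaTerm_add_one hq hz, sub_add_cancel]
      have x1 : q ^ ((n : ℤ) - m + 1) * q ^ (m - 1) = q ^ n := by
        rw [← zpow_add₀ hq, ← zpow_natCast]; congr 1; ring
      have x2 : q ^ ((n : ℤ) + m + 1) = q * q ^ n * q ^ m := by
        rw [mul_right_comm, ← zpow_one_add₀ hq, ← zpow_natCast, ← zpow_add₀ hq]; congr 1; ring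
      have x3 : thetaTerm q z m * q ^ ((n : ℤ) - m + 1) = -(z * q ^ n) * thetaTerm q z (m - 1) := by
        rw [t1, ← x1]; ring
      have x4 : thetaTerm q z m * q ^ ((n : ℤ) + m + 1) =
          -(q / z * q ^ n) * thetaTerm q z (m + 1) := by
        rw [thetaTerm_add_one hq hz, x2]; field_simp
      rw [jacobiCoeff_succ hq hq1]
      linear_combination jacobiCoeff q n (m - 1) * x3 + jacobiCoeff q n (m + 1) * x4
    rw [e1]
    refine Eq.subst (motive := HasSum _) ?_ h
    rw [Finset.prod_range_succ, Finset.prod_range_succ]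
    field_simp
    ring

theorem norm_recipQFactorial_le {q : ℂ} (hq1 : ‖q‖ < 1) :
    ∃ C, ∀ k, ‖recipQFactorial q k‖ ≤ C := by
  have h := (tendsto_poch q hq1).inv₀ (euler_ne_zero hq1)
  obtain ⟨C, hC⟩ := h.norm.bddAbove_range
  refine ⟨max C 0, fun k => ?_⟩
  rw [recipQFactorial]
  split_ifs
  · exact le_max_of_le_left (hC ⟨k.toNat, rfl⟩)
  · simp

theorem tendsto_jacobiCoeff {q : ℂ} (hq1 : ‖q‖ < 1) (m : ℤ) :
    Tendsto (fun n => jacobiCoeff q n m) atTop (𝓝 (euler q)⁻¹) := by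
  have h0 := tendsto_poch q hq1
  have h1 : Tendsto (recipQFactorial q) atTop (𝓝 (euler q)⁻¹) := by
    have h : Tendsto Int.toNat atTop atTop :=
      tendsto_atTop_mono (f := fun k : ℤ => k.toNat) (fun k => le_rfl)
        (tendsto_atTop.2 fun b => (eventually_ge_atTop (b : ℤ)).mono fun k hk => by omega)
    refine ((h0.inv₀ (euler_ne_zero hq1)).comp h).congr' ?_
    filter_upwards [eventually_ge_atTop (0 : ℤ)] with k hk
    simp [recipQFactorial, hk]
  have c : Tendsto (fun n : ℕ => (n : ℤ)) atTop atTop := tendsto_natCast_atTop_atTop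
  have h2 := h1.comp (tendsto_atTop_add_const_right _ (-m) c)
  have h3 := h1.comp (tendsto_atTop_add_const_right _ m c)
  have h4 := h0.comp (tendsto_id.const_mul_atTop' (two_pos (α := ℕ)))
  have := h4.mul (h2.mul h3)
  have e : poch q q * ((euler q)⁻¹ * (euler q)⁻¹) = (euler q)⁻¹ := by
    have := euler_ne_zero hq1
    rw [← euler]; field_simp
  rw [e] at this
  exact this

/-- The **Jacobi triple product** identity. -/
theorem theta_eq_prod {q z : ℂ} (hq : q ≠ 0) (hq1 : ‖q‖ < 1) (hz : z ≠ 0) :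
    theta q z = euler q * poch z q * poch (q / z) q := by
  have h1 := (tendsto_poch z hq1).mul (tendsto_poch (q / z) hq1)
  obtain ⟨C, hC⟩ := norm_recipQFactorial_le hq1
  obtain ⟨D, hD⟩ := (tendsto_poch q hq1).norm.bddAbove_range
  have hC0 : 0 ≤ C := (norm_nonneg _).trans (hC 0)
  have h2 : Tendsto (fun n => ∑' m : ℤ, thetaTerm q z m * jacobiCoeff q n m) atTop
      (𝓝 (∑' m : ℤ, thetaTerm q z m * (euler q)⁻¹)) := by
    -- The finite products are bounded by D and their reciprocals by C, uniformly in n and m, so the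
    -- absolutely convergent theta series dominates.
    refine tendsto_tsum_of_dominated_convergence
      (bound := fun m => ‖thetaTerm q z m‖ * (D * (C * C)))
      ((summable_norm_thetaTerm hq hq1 hz).mul_right _)
      (fun m => (tendsto_jacobiCoeff hq1 m).const_mul _) (Eventually.of_forall fun n m => ?_)
    rw [norm_mul, jacobiCoeff, norm_mul, norm_mul]
    have hDn := hD ⟨2 * n, rfl⟩
    have := (norm_nonneg _).trans hDn
    have := hC (n - m)
    have := hC (n + m)
    gcongr
  simp_rw [(hasSum_jacobiCoeff hq hq1 hz _).tsum_eq] at h2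
  rw [tsum_mul_right, ← theta] at h2
  have h3 := tendsto_nhds_unique h2 h1
  have := euler_ne_zero hq1
  field_simp at h3
  rw [h3]

/-! ### Parity splitting of a product of two theta values -/

theorem thetaTerm_sq_neg_mul_sq {q : ℂ} (hq : q ≠ 0) (a : ℂ) (i : ℤ) :
    thetaTerm (q ^ 2) (-(q * a ^ 2)) i = q ^ (i ^ 2) * a ^ (2 * i) := by
  have h : i ^ 2 = 2 * (i * (i - 1) / 2) + i := by rw [two_mul_triangle]; ring
  rw [thetaTerm, neg_eq_neg_one_mul (q * a ^ 2), mul_zpow, mul_zpow, h, zpow_add₀ hq, zpow_mul,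
    zpow_mul, zpow_ofNat, zpow_ofNat]
  have : (-1 : ℂ) ^ i * (-1) ^ i = 1 := by rw [← mul_zpow]; norm_num
  linear_combination (q ^ 2) ^ (i * (i - 1) / 2) * q ^ i * (a ^ 2) ^ i * this

theorem thetaTerm_sq_neg_sq (q a : ℂ) (i : ℤ) :
    thetaTerm (q ^ 2) (-a ^ 2) i = q ^ (i ^ 2 - i) * a ^ (2 * i) := by
  have h : i ^ 2 - i = 2 * (i * (i - 1) / 2) := by rw [two_mul_triangle]; ring
  rw [thetaTerm, neg_eq_neg_one_mul (a ^ 2), mul_zpow, h, zpow_mul, zpow_mul, zpow_ofNat,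
    zpow_ofNat]
  have : (-1 : ℂ) ^ i * (-1) ^ i = 1 := by rw [← mul_zpow]; norm_num
  linear_combination (q ^ 2) ^ (i * (i - 1) / 2) * (a ^ 2) ^ i * this

/-- `ℤ × ℤ` split according to the parity of the sum of the coordinates. -/
noncomputable def paritySplit : Bool × ℤ × ℤ ≃ ℤ × ℤ :=
  Equiv.ofBijective
    (fun p => if p.1 then (p.2.1 + p.2.2, p.2.2 - p.2.1)
      else (p.2.1 + p.2.2, p.2.2 - p.2.1 + 1)) <| by
    constructor
    · rintro ⟨a, x, y⟩ ⟨b, u, v⟩ h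
      cases a <;> cases b <;> simp at h ⊢ <;> omega
    · rintro ⟨x, y⟩
      rcases Int.even_or_odd' (x + y) with ⟨k, hk | hk⟩
      · exact ⟨(true, x - k, k), Prod.ext (by simp) (by simp; omega)⟩
      · exact ⟨(false, x - k, k), Prod.ext (by simp) (by simp; omega)⟩

theorem paritySplit_true (i j : ℤ) : paritySplit (true, i, j) = (i + j, j - i) := rfl

theorem paritySplit_false (i j : ℤ) : paritySplit (false, i, j) = (i + j, j - i + 1) := rfl

theorem theta_mul_theta_eq_tsum {q r z w : ℂ} (hq : q ≠ 0) (hq1 : ‖q‖ < 1) (hz : z ≠ 0)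
    (hr : r ≠ 0) (hr1 : ‖r‖ < 1) (hw : w ≠ 0) :
    theta q z * theta r w = ∑' p : ℤ × ℤ, thetaTerm q z p.1 * thetaTerm r w p.2 :=
  tsum_mul_tsum_of_summable_norm (summable_norm_thetaTerm hq hq1 hz)
    (summable_norm_thetaTerm hr hr1 hw)

theorem summable_thetaTerm_mul {q r z w : ℂ} (hq : q ≠ 0) (hq1 : ‖q‖ < 1) (hz : z ≠ 0)
    (hr : r ≠ 0) (hr1 : ‖r‖ < 1) (hw : w ≠ 0) :
    Summable fun p : ℤ × ℤ => thetaTerm q z p.1 * thetaTerm r w p.2 :=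
  summable_mul_of_summable_norm (summable_norm_thetaTerm hq hq1 hz)
    (summable_norm_thetaTerm hr hr1 hw)

theorem tsum_eq_sum_tsum_of_equiv {ι κ α : Type*} [Fintype ι] (e : ι × κ ≃ α) {f : α → ℂ}
    (hf : Summable f) : ∑' x, f x = ∑ i, ∑' k, f (e (i, k)) := by
  rw [← e.tsum_eq, ← tsum_fintype (L := .unconditional ι)]
  exact (e.summable_iff.2 hf).tsum_prod

/-- The even component in the two-term decomposition of `theta q (a * b) * theta q (b / a)`. -/
noncomputable def thetaEven (q a : ℂ) : ℂ := theta (q ^ 2) (-(q * a ^ 2))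

/-- The odd component in the two-term decomposition of `theta q (a * b) * theta q (b / a)`. -/
noncomputable def thetaOdd (q a : ℂ) : ℂ := theta (q ^ 2) (-a ^ 2) / a

/-- In the coordinates (i + j, j - i) or (i + j, j - i + 1), the exponents of a and b separate, as
does the quadratic form. The result is b times a 2 × 2 determinant of vectors attached to a and b,
so products of such theta values obey Plücker relations. -/
theorem theta_mul_mul_theta_div {q a b : ℂ} (hq : q ≠ 0) (hq1 : ‖q‖ < 1) (ha : a ≠ 0)
    (hb : b ≠ 0) :
    theta q (a * b) * theta q (b / a) =
      b * (thetaEven q a * thetaOdd q b - thetaOdd q a * thetaEven q b) := by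
  have hq2 : q ^ 2 ≠ 0 := pow_ne_zero _ hq
  have hq21 : ‖q ^ 2‖ < 1 := norm_pow_lt_one hq1 two_ne_zero
  have ha1 : -(q * a ^ 2) ≠ 0 := by simp [hq, ha]
  have hb1 : -(q * b ^ 2) ≠ 0 := by simp [hq, hb]
  have ha2 : -a ^ 2 ≠ 0 := by simp [ha]
  have hb2 : -b ^ 2 ≠ 0 := by simp [hb]
  have e : b * (thetaEven q a * thetaOdd q b - thetaOdd q a * thetaEven q b) =
      theta (q ^ 2) (-(q * a ^ 2)) * theta (q ^ 2) (-b ^ 2) +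
      -(b / a) * (theta (q ^ 2) (-a ^ 2) * theta (q ^ 2) (-(q * b ^ 2))) := by
    simp only [thetaEven, thetaOdd]
    field_simp
    ring
  rw [e, theta_mul_theta_eq_tsum hq2 hq21 ha1 hq2 hq21 hb2,
    theta_mul_theta_eq_tsum hq2 hq21 ha2 hq2 hq21 hb1,
    theta_mul_theta_eq_tsum hq hq1 (mul_ne_zero ha hb) hq hq1 (div_ne_zero hb ha),
    tsum_eq_sum_tsum_of_equiv paritySplit
      (summable_thetaTerm_mul hq hq1 (mul_ne_zero ha hb) hq hq1 (div_ne_zero hb ha)),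
    Fintype.sum_bool, ← tsum_mul_left]
  congr 1
  · refine tsum_congr fun ⟨i, j⟩ => ?_
    rw [paritySplit_true, thetaTerm_sq_neg_mul_sq hq, thetaTerm_sq_neg_sq, thetaTerm, thetaTerm, mul_zpow, div_zpow]
    have h1 := two_mul_triangle (i + j)
    have h2 := two_mul_triangle (j - i)
    have s : (-1 : ℂ) ^ (i + j) * (-1) ^ (j - i) = 1 := by
      rw [← zpow_add₀ (by norm_num), show i + j + (j - i) = 2 * j by ring, zpow_mul]; norm_num
    have hx : q ^ (i ^ 2) * q ^ (j ^ 2 - j) =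
        q ^ ((i + j) * (i + j - 1) / 2) * q ^ ((j - i) * (j - i - 1) / 2) := by
      rw [← zpow_add₀ hq, ← zpow_add₀ hq]; congr 1; linarith
    have hA : a ^ (2 * i) = a ^ (i + j) / a ^ (j - i) := by
      rw [← zpow_sub₀ ha]; congr 1; ring
    have hB : b ^ (2 * j) = b ^ (i + j) * b ^ (j - i) := by
      rw [← zpow_add₀ hb]; congr 1; ring
    calc _ = (-1 : ℂ) ^ (i + j) * (-1) ^ (j - i) * (q ^ ((i + j) * (i + j - 1) / 2) *
          q ^ ((j - i) * (j - i - 1) / 2)) * (a ^ (i + j) / a ^ (j - i)) *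
          (b ^ (i + j) * b ^ (j - i)) := by ring
      _ = _ := by rw [s, ← hx, ← hA, ← hB]; ring
  · refine tsum_congr fun ⟨i, j⟩ => ?_
    rw [paritySplit_false, thetaTerm_sq_neg_mul_sq hq, thetaTerm_sq_neg_sq, thetaTerm, thetaTerm, mul_zpow, div_zpow]
    have h1 := two_mul_triangle (i + j)
    have h2 := two_mul_triangle (j - i + 1)
    have s : (-1 : ℂ) ^ (i + j) * (-1) ^ (j - i + 1) = -1 := by
      rw [← zpow_add₀ (by norm_num), show i + j + (j - i + 1) = 2 * j + 1 by ring,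
        zpow_add₀ (by norm_num), zpow_mul]; norm_num
    have hx : q ^ (i ^ 2 - i) * q ^ (j ^ 2) =
        q ^ ((i + j) * (i + j - 1) / 2) * q ^ ((j - i + 1) * (j - i + 1 - 1) / 2) := by
      rw [← zpow_add₀ hq, ← zpow_add₀ hq]; congr 1; linarith
    have hA : a ^ (2 * i) / a = a ^ (i + j) / a ^ (j - i + 1) := by
      rw [← zpow_sub₀ ha, div_eq_mul_inv, ← zpow_sub_one₀ ha]; congr 1; ring
    have hB : b ^ (2 * j) * b = b ^ (i + j) * b ^ (j - i + 1) := by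
      rw [← zpow_add₀ hb, ← zpow_add_one₀ hb]; congr 1; ring
    calc _ = (-1 : ℂ) ^ (i + j) * (-1) ^ (j - i + 1) * (q ^ ((i + j) * (i + j - 1) / 2) *
          q ^ ((j - i + 1) * (j - i + 1 - 1) / 2)) * (a ^ (i + j) / a ^ (j - i + 1)) *
          (b ^ (i + j) * b ^ (j - i + 1)) := by ring
      _ = _ := by rw [s, ← hx, ← hA, ← hB]; ring

/-! ### Differentiating infinite products, and the Weierstrass function -/

theorem norm_prod_one_add_sub_one_sub_sum_le {ι : Type*} (t : Finset ι) (f : ι → ℂ) :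
    ‖∏ i ∈ t, (1 + f i) - 1 - ∑ i ∈ t, f i‖ ≤ Real.exp (∑ i ∈ t, ‖f i‖) - 1 - ∑ i ∈ t, ‖f i‖ := by
  classical
  induction t using Finset.induction_on with
  | empty => simp
  | insert i t hi ih =>
    rw [Finset.prod_insert hi, Finset.sum_insert hi, Finset.sum_insert hi, Real.exp_add]
    have h1 := t.norm_prod_one_add_sub_one_le f
    have h2 := Real.add_one_le_exp ‖f i‖
    have h3 := Real.exp_pos (∑ i ∈ t, ‖f i‖)
    calc _ = ‖(∏ i ∈ t, (1 + f i) - 1 - ∑ i ∈ t, f i) + f i * (∏ i ∈ t, (1 + f i) - 1)‖ := by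
          congr 1; ring
      _ ≤ _ := norm_add_le _ _
      _ ≤ (Real.exp (∑ i ∈ t, ‖f i‖) - 1 - ∑ i ∈ t, ‖f i‖) +
          ‖f i‖ * (Real.exp (∑ i ∈ t, ‖f i‖) - 1) := by
          rw [norm_mul]; gcongr
      _ ≤ _ := by nlinarith

theorem norm_tprod_one_add_sub_one_sub_tsum_le {f : ℕ → ℂ} (hf : Summable fun n => ‖f n‖) :
    ‖∏' n, (1 + f n) - 1 - ∑' n, f n‖ ≤ Real.exp (∑' n, ‖f n‖) - 1 - ∑' n, ‖f n‖ := by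
  have h1 := ((multipliable_one_add_of_summable hf).hasProd.sub_const 1).sub hf.of_norm.hasSum
  have h2 := ((Real.continuous_exp.tendsto _).comp hf.hasSum).sub_const 1 |>.sub hf.hasSum
  exact le_of_tendsto_of_tendsto' h1.norm h2 fun t => norm_prod_one_add_sub_one_sub_sum_le t f

/-- The linear Taylor error of the product is at most eˢ - 1 - s with s = |w|∑|u n|, which is at
most s² for s ≤ 1. -/
theorem hasDerivAt_tprod_one_sub_mul {u : ℕ → ℂ} (hu : Summable fun n => ‖u n‖) :
    HasDerivAt (fun w : ℂ => ∏' n, (1 - w * u n)) (-∑' n, u n) 0 := by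
  rw [hasDerivAt_iff_isLittleO]
  have h : (fun w : ℂ => w ^ 2) =o[𝓝 0] fun w => w := by
    simpa using Asymptotics.isLittleO_pow_pow (𝕜 := ℂ) one_lt_two
  simp only [sub_zero]
  refine Asymptotics.IsBigO.trans_isLittleO
    (Asymptotics.IsBigO.of_bound ((∑' n, ‖u n‖) ^ 2) ?_) h
  have hs : Tendsto (fun w : ℂ => ‖w‖ * ∑' n, ‖u n‖) (𝓝 0) (𝓝 0) := by
    simpa using (tendsto_norm_zero (E := ℂ)).mul_const (∑' n, ‖u n‖)
  filter_upwards [hs.eventually (ge_mem_nhds one_pos)] with w hw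
  have hf : Summable fun n => ‖-(w * u n)‖ := by simpa using hu.mul_left ‖w‖
  have h1 := norm_tprod_one_add_sub_one_sub_tsum_le hf
  simp only [norm_neg, norm_mul, tsum_mul_left, tsum_neg] at h1
  have h0 : 0 ≤ ‖w‖ * ∑' n, ‖u n‖ := mul_nonneg (norm_nonneg _) (tsum_nonneg fun _ => norm_nonneg _)
  have h2 := (le_abs_self _).trans (Real.abs_exp_sub_one_sub_id_le ((abs_of_nonneg h0).trans_le hw))
  calc _ = ‖∏' n, (1 + -(w * u n)) - 1 - -(w * ∑' n, u n)‖ := by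
        simp [sub_eq_add_neg]
    _ ≤ _ := h1.trans h2
    _ = _ := by rw [norm_pow]; ring

theorem summable_norm_div_one_sub_sq (b : ℂ) {q : ℂ} (hq1 : ‖q‖ < 1) :
    Summable fun n : ℕ => ‖b * q ^ n / (1 - b * q ^ n) ^ 2‖ := by
  have h0 : Tendsto (fun n : ℕ => b * q ^ n) atTop (𝓝 0) := by
    simpa using (tendsto_pow_atTop_nhds_zero_of_norm_lt_one hq1).const_mul b
  have h1 : Tendsto (fun n : ℕ => ((1 - b * q ^ n) ^ 2)⁻¹) atTop (𝓝 1) := by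
    simpa using ((h0.const_sub 1).pow 2).inv₀ (by simp)
  have h2 : Summable fun n : ℕ => b * q ^ n := (summable_geometric_of_norm_lt_one hq1).mul_left b
  refine (summable_of_isBigO_nat h2.norm ?_ : Summable fun n : ℕ => b * q ^ n *
    ((1 - b * q ^ n) ^ 2)⁻¹).norm
  simpa using (Asymptotics.isBigO_refl (fun n : ℕ => b * q ^ n) atTop).norm_right.mul
    (h1.isBigO_one ℝ)

/-- The infinite product `∏ (1 - w b q ^ n / (1 - b q ^ n) ^ 2)` over `n ≥ 0`. -/
noncomputable def pochRatio (b q w : ℂ) : ℂ := ∏' n : ℕ, (1 - w * (b * q ^ n / (1 - b * q ^ n) ^ 2))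

/-- Factor by factor, (1 - aX)(1 - X/a) = (1 - X)² - ((1 - a)²/a)X with X = bqⁿ. The dependence on a
is thus only through w = (1 - a)²/a, a parameter vanishing at a = 1. -/
theorem poch_mul_mul_poch_div {a b q : ℂ} (hq1 : ‖q‖ < 1) (ha : a ≠ 0)
    (hb : ∀ n : ℕ, b * q ^ n ≠ 1) :
    poch (a * b) q * poch (b / a) q = poch b q ^ 2 * pochRatio b q ((1 - a) ^ 2 / a) := by
  have hm : Multipliable fun n : ℕ => 1 - (1 - a) ^ 2 / a * (b * q ^ n / (1 - b * q ^ n) ^ 2) := by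
    have := multipliable_one_add_of_summable
      (f := fun n : ℕ => -((1 - a) ^ 2 / a * (b * q ^ n / (1 - b * q ^ n) ^ 2)))
      (by simpa only [norm_neg, norm_mul] using
        (summable_norm_div_one_sub_sq b hq1).mul_left ‖(1 - a) ^ 2 / a‖)
    simpa only [sub_eq_add_neg] using this
  have hp := multipliable_poch b hq1
  rw [sq (poch b q), poch, poch, poch, pochRatio,
    ← (multipliable_poch _ hq1).tprod_mul (multipliable_poch _ hq1), ← hp.tprod_mul hp,
    ← (hp.mul hp).tprod_mul hm]
  refine tprod_congr fun n => ?_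
  have := sub_ne_zero.2 (hb n).symm
  field_simp
  ring

theorem hasDerivAt_pochRatio (b : ℂ) {q : ℂ} (hq1 : ‖q‖ < 1) :
    HasDerivAt (pochRatio b q) (-∑' n : ℕ, b * q ^ n / (1 - b * q ^ n) ^ 2) 0 :=
  hasDerivAt_tprod_one_sub_mul (summable_norm_div_one_sub_sq b hq1)

theorem pochRatio_zero (b q : ℂ) : pochRatio b q 0 = 1 := by simp [pochRatio]

/-- The Weierstrass function of the multiplicative lattice generated by `q`, up to a constant. -/
noncomputable def wpSum (q b : ℂ) : ℂ :=
  ∑' n : ℕ, b * q ^ n / (1 - b * q ^ n) ^ 2 + ∑' n : ℕ, q / b * q ^ n / (1 - q / b * q ^ n) ^ 2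

theorem theta_mul_mul_theta_div_eq_sq {q a b : ℂ} (hq : q ≠ 0) (hq1 : ‖q‖ < 1) (ha : a ≠ 0)
    (hb0 : b ≠ 0) (hb : ∀ n : ℕ, b * q ^ n ≠ 1) (hb' : ∀ n : ℕ, q / b * q ^ n ≠ 1) :
    theta q (a * b) * theta q (b / a) = theta q b ^ 2 *
      (pochRatio b q ((1 - a) ^ 2 / a) * pochRatio (q / b) q ((1 - a) ^ 2 / a)) := by
  have h1 := poch_mul_mul_poch_div hq1 ha hb
  have h2 := poch_mul_mul_poch_div hq1 ha hb'
  rw [theta_eq_prod hq hq1 (mul_ne_zero ha hb0), theta_eq_prod hq hq1 (div_ne_zero hb0 ha),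
    theta_eq_prod hq hq1 hb0]
  have e1 : q / (a * b) = q / b / a := by field_simp
  have e2 : q / (b / a) = a * (q / b) := by field_simp
  rw [e1, e2]
  linear_combination euler q ^ 2 * poch (a * (q / b)) q * poch (q / b / a) q * h1 +
    euler q ^ 2 * poch b q ^ 2 * pochRatio b q ((1 - a) ^ 2 / a) * h2

/-- Once the factor 1 - a is peeled off, the two remaining products are the case b = q of
`poch_mul_mul_poch_div`. -/
theorem theta_sq_eq {q a : ℂ} (hq : q ≠ 0) (hq1 : ‖q‖ < 1) (ha : a ≠ 0) :
    theta q a ^ 2 = (1 - a) ^ 2 * euler q ^ 6 * pochRatio q q ((1 - a) ^ 2 / a) ^ 2 := by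
  have h := poch_mul_mul_poch_div hq1 ha (b := q) fun n h =>
    one_sub_mul_pow_ne_zero hq1 n (sub_eq_zero.2 h.symm)
  rw [theta_eq_prod hq hq1 ha, poch_eq_mul a hq1]
  rw [← euler] at h
  linear_combination euler q ^ 2 * (1 - a) ^ 2 * (poch (a * q) q * poch (q / a) q +
    euler q ^ 2 * pochRatio q q ((1 - a) ^ 2 / a)) * h

theorem theta_ne_zero {q b : ℂ} (hq : q ≠ 0) (hq1 : ‖q‖ < 1) (hb0 : b ≠ 0)
    (hb : ∀ n : ℕ, b * q ^ n ≠ 1) (hb' : ∀ n : ℕ, q / b * q ^ n ≠ 1) : theta q b ≠ 0 := by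
  rw [theta_eq_prod hq hq1 hb0]
  exact mul_ne_zero (mul_ne_zero (euler_ne_zero hq1) (poch_ne_zero hq1 hb)) (poch_ne_zero hq1 hb')

/-- The product formula for a difference of two values of the Weierstrass function. -/
theorem wpSum_sub_wpSum {q b c : ℂ} (hq : q ≠ 0) (hq1 : ‖q‖ < 1)
    (hb0 : b ≠ 0) (hb : ∀ n : ℕ, b * q ^ n ≠ 1) (hb' : ∀ n : ℕ, q / b * q ^ n ≠ 1)
    (hc0 : c ≠ 0) (hc : ∀ n : ℕ, c * q ^ n ≠ 1) (hc' : ∀ n : ℕ, q / c * q ^ n ≠ 1) :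
    wpSum q b - wpSum q c = euler q ^ 6 * b * (theta q (b * c) * theta q (c / b)) /
      (theta q b * theta q c) ^ 2 := by
  have hbt := theta_ne_zero hq hq1 hb0 hb hb'
  have hct := theta_ne_zero hq hq1 hc0 hc hc'
  set K := euler q ^ 6 * b * (theta q (b * c) * theta q (c / b)) / (theta q b * theta q c) ^ 2
    with hK
  -- The theta identity is rewritten as an identity of functions of w alone. Its derivative at w = 0
  -- is the claim.
  have key : (fun w => pochRatio b q w * pochRatio (q / b) q w -
      pochRatio c q w * pochRatio (q / c) q w) = fun w => w * (-K * pochRatio q q w ^ 2) := by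
    funext w
    -- Here a is a root of a² - (2 + w)a + 1, which is nonzero because the constant term is 1.
    obtain ⟨a, ha, rfl⟩ : ∃ a : ℂ, a ≠ 0 ∧ (1 - a) ^ 2 / a = w := by
      obtain ⟨a, ha⟩ := exists_quadratic_eq_zero (a := (1 : ℂ)) (b := -(2 + w)) (c := 1)
        one_ne_zero (IsAlgClosed.exists_eq_mul_self _)
      have h0 : a ≠ 0 := by
        rintro rfl
        simp at ha
      exact ⟨a, h0, by field_simp; linear_combination ha⟩
    have h1 := theta_mul_mul_theta_div_eq_sq hq hq1 ha hb0 hb hb'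
    have h2 := theta_mul_mul_theta_div_eq_sq hq hq1 ha hc0 hc hc'
    have h3 := theta_sq_eq hq hq1 ha
    have g1 := theta_mul_mul_theta_div hq hq1 ha hb0
    have g2 := theta_mul_mul_theta_div hq hq1 ha hc0
    have g3 := theta_mul_mul_theta_div hq hq1 hb0 hc0
    have k1 := theta_mul_mul_theta_div hq hq1 one_ne_zero hb0
    have k2 := theta_mul_mul_theta_div hq hq1 one_ne_zero hc0
    have k3 := theta_mul_mul_theta_div hq hq1 one_ne_zero ha
    rw [one_mul, div_one] at k1 k2 k3
    rw [h1] at g1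
    rw [h2] at g2
    rw [← sq] at k1 k2 k3
    rw [h3] at k3
    generalize pochRatio b q ((1 - a) ^ 2 / a) * pochRatio (q / b) q ((1 - a) ^ 2 / a) = B at *
    generalize pochRatio c q ((1 - a) ^ 2 / a) * pochRatio (q / c) q ((1 - a) ^ 2 / a) = C at *
    generalize pochRatio q q ((1 - a) ^ 2 / a) = G at *
    -- This is the Plücker relation for the four vectors (`thetaEven`, `thetaOdd`) at 1, a, b, c.
    have main : (B - C) * (theta q b ^ 2 * theta q c ^ 2) * a =
        -((1 - a) ^ 2 * euler q ^ 6 * G ^ 2) * (b * (theta q (b * c) * theta q (c / b))) := by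
      rw [k3, g3]
      have : (B - C) * (theta q b ^ 2 * theta q c ^ 2) * a = (theta q b ^ 2 * B) * theta q c ^ 2 * a
        - (theta q c ^ 2 * C) * theta q b ^ 2 * a := by ring
      rw [this, g1, g2, k1, k2]
      ring
    rw [hK]
    field_simp
    linear_combination main
  have d1 := ((hasDerivAt_pochRatio b hq1).mul (hasDerivAt_pochRatio (q / b) hq1)).sub
    ((hasDerivAt_pochRatio c hq1).mul (hasDerivAt_pochRatio (q / c) hq1))
  have d2 := (hasDerivAt_id (0 : ℂ)).mul
    (((hasDerivAt_pochRatio q hq1).pow 2).const_mul (-K))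
  have h := HasDerivAt.unique d1 (by
    refine d2.congr_of_eventuallyEq (Eventually.of_forall fun w => ?_)
    exact congrFun key w)
  simp only [pochRatio_zero, Pi.pow_apply] at h
  simp only [wpSum]
  simp at h
  linear_combination -h

/-! ### Quadratic theta relations from the Gaussian integers modulo 2 + i -/

/-- The five centres `0, ±1, ±i` tiling the Gaussian integers modulo `2 + i`. -/
def crossPoint : Fin 5 → ℤ × ℤ := ![(0, 0), (1, 0), (-1, 0), (0, 1), (0, -1)]

/-- `ℤ × ℤ` split into the five cosets of the ideal generated by `2 + i`. -/
noncomputable def crossSplit : Fin 5 × ℤ × ℤ ≃ ℤ × ℤ :=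
  Equiv.ofBijective (fun p => (p.2.1 + 2 * p.2.2 + (crossPoint p.1).1,
    p.2.2 - 2 * p.2.1 + (crossPoint p.1).2)) <| by
    constructor
    · rintro ⟨a, x, y⟩ ⟨b, u, v⟩ h
      fin_cases a <;> fin_cases b <;> simp [crossPoint] at h ⊢ <;> omega
    · rintro ⟨x, y⟩
      have h : (2 * x + y) % 5 = 0 ∨ (2 * x + y) % 5 = 1 ∨ (2 * x + y) % 5 = 2 ∨
        (2 * x + y) % 5 = 3 ∨ (2 * x + y) % 5 = 4 := by omega
      rcases h with h | h | h | h | h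
      · exact ⟨(0, (x - 2 * y) / 5, (2 * x + y) / 5), by ext <;> simp [crossPoint] <;> omega⟩
      · exact ⟨(3, (x - 2 * (y - 1)) / 5, (2 * x + y) / 5),
          by ext <;> simp [crossPoint] <;> omega⟩
      · exact ⟨(1, (x - 1 - 2 * y) / 5, (2 * x + y) / 5),
          by ext <;> simp [crossPoint] <;> omega⟩
      · exact ⟨(2, (x + 1 - 2 * y) / 5, (2 * x + y + 2) / 5),
          by ext <;> simp [crossPoint] <;> omega⟩
      · exact ⟨(4, (x - 2 * (y + 1)) / 5, (2 * x + y + 1) / 5),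
          by ext <;> simp [crossPoint] <;> omega⟩

theorem crossSplit_apply (r : Fin 5) (u v : ℤ) : crossSplit (r, u, v) =
    (u + 2 * v + (crossPoint r).1, v - 2 * u + (crossPoint r).2) := rfl

theorem thetaTerm_sq_self {q : ℂ} (hq : q ≠ 0) (x : ℤ) :
    thetaTerm (q ^ 2) q x = (-1) ^ x * q ^ (x ^ 2) := by
  have h : x ^ 2 = 2 * (x * (x - 1) / 2) + x := by rw [two_mul_triangle]; ring
  rw [thetaTerm, h, zpow_add₀ hq, zpow_mul, zpow_ofNat, mul_assoc]

theorem thetaTerm_pow_ten {q : ℂ} (hq : q ≠ 0) (k : ℕ) (u : ℤ) :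
    thetaTerm (q ^ 10) (q ^ k) u = (-1) ^ u * q ^ (5 * u ^ 2 - 5 * u + k * u) := by
  have h : 5 * u ^ 2 - 5 * u = 10 * (u * (u - 1) / 2) := by linarith [two_mul_triangle u]
  rw [thetaTerm, h, zpow_add₀ hq, zpow_mul, zpow_mul, zpow_ofNat, zpow_natCast, mul_assoc]

theorem thetaTerm_neg_zpow {q : ℂ} (hq : q ≠ 0) (m : ℕ) (k u : ℤ) :
    thetaTerm (q ^ m) (-q ^ k) u = q ^ (m * (u * (u - 1) / 2) + k * u) := by
  have : (-1 : ℂ) ^ u * (-1) ^ u = 1 := by rw [← mul_zpow]; norm_num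
  rw [thetaTerm, neg_eq_neg_one_mul (q ^ k), mul_zpow, zpow_add₀ hq, zpow_mul, zpow_mul,
    zpow_natCast]
  linear_combination (q ^ m) ^ (u * (u - 1) / 2) * (q ^ k) ^ u * this

/-- Multiplication by 2 + i scales x² + y² by 5, so on each coset the double series factors into two
theta series of nome q¹⁰. The zero coset gives the square; the four unit cosets agree by the
symmetry z ↦ q¹⁰/z and carry the sign -1. -/
theorem theta_sq_self_sq {q : ℂ} (hq : q ≠ 0) (hq1 : ‖q‖ < 1) :
    theta (q ^ 2) q ^ 2 = theta (q ^ 10) (q ^ 5) ^ 2 -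
      4 * q * (theta (q ^ 10) q * theta (q ^ 10) (q ^ 3)) := by
  have hq2 : q ^ 2 ≠ 0 := pow_ne_zero _ hq
  have hq21 : ‖q ^ 2‖ < 1 := norm_pow_lt_one hq1 two_ne_zero
  have hq10 : q ^ 10 ≠ 0 := pow_ne_zero _ hq
  have hq101 : ‖q ^ 10‖ < 1 := norm_pow_lt_one hq1 (by norm_num)
  have s : ∀ u v c d : ℤ, (-1 : ℂ) ^ (u + 2 * v + c) * (-1 : ℂ) ^ (v - 2 * u + d) =
      (-1) ^ (c + d) * ((-1) ^ u * (-1) ^ v) := fun u v c d => by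
    have : (-1 : ℂ) ≠ 0 := by norm_num
    rw [← zpow_add₀ this, ← zpow_add₀ this, ← zpow_add₀ this,
      show u + 2 * v + c + (v - 2 * u + d) = c + d + (u + v) + 2 * (v - u) by ring,
      zpow_add₀ this, zpow_mul]
    norm_num
  have step : ∀ (r : Fin 5) (a b e : ℕ) (σ : ℂ), (-1 : ℂ) ^ ((crossPoint r).1 + (crossPoint r).2) = σ →
      (∀ u v : ℤ, (u + 2 * v + (crossPoint r).1) ^ 2 + (v - 2 * u + (crossPoint r).2) ^ 2 =
        e + (5 * u ^ 2 - 5 * u + a * u) + (5 * v ^ 2 - 5 * v + b * v)) →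
      ∑' p : ℤ × ℤ, thetaTerm (q ^ 2) q (crossSplit (r, p)).1 *
        thetaTerm (q ^ 2) q (crossSplit (r, p)).2 =
        σ * q ^ e * (theta (q ^ 10) (q ^ a) * theta (q ^ 10) (q ^ b)) := by
    intro r a b e σ hσ h
    rw [theta_mul_theta_eq_tsum hq10 hq101 (pow_ne_zero _ hq) hq10 hq101 (pow_ne_zero _ hq),
      ← tsum_mul_left]
    refine tsum_congr fun ⟨u, v⟩ => ?_
    rw [crossSplit_apply, thetaTerm_sq_self hq, thetaTerm_sq_self hq, thetaTerm_pow_ten hq,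
      thetaTerm_pow_ten hq, mul_mul_mul_comm, s, hσ, ← zpow_add₀ hq, h, zpow_add₀ hq, zpow_add₀ hq,
      zpow_natCast]
    ring
  have t7 : theta (q ^ 10) (q ^ 7) = theta (q ^ 10) (q ^ 3) := by
    rw [← theta_div hq10]; congr 1; field_simp
  have t9 : theta (q ^ 10) (q ^ 9) = theta (q ^ 10) (q ^ 1) := by
    rw [← theta_div hq10]; congr 1; field_simp
  rw [sq, theta_mul_theta_eq_tsum hq2 hq21 hq hq2 hq21 hq, tsum_eq_sum_tsum_of_equiv crossSplit
    (summable_thetaTerm_mul hq2 hq21 hq hq2 hq21 hq), Fin.sum_univ_five,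
    step 0 5 5 0 1 (by simp [crossPoint]) (by intro u v; simp [crossPoint]; ring),
    step 1 7 9 1 (-1) (by simp [crossPoint]) (by intro u v; simp [crossPoint]; ring),
    step 2 3 1 1 (-1) (by simp [crossPoint]) (by intro u v; simp [crossPoint]; ring),
    step 3 1 7 1 (-1) (by simp [crossPoint]) (by intro u v; simp [crossPoint]; ring),
    step 4 9 3 1 (-1) (by simp [crossPoint]) (by intro u v; simp [crossPoint]; ring), t7, t9]
  simp only [pow_one]
  ring

/-- The same five cosets serve for triangular exponents, which are centred at (1/2, 1/2). The
zero-coset map sends (1/2, 1/2) to (3/2, -1/2), so a shift by (-1, 1) restores the centre. -/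
theorem theta_neg_one_sq {q : ℂ} (hq : q ≠ 0) (hq1 : ‖q‖ < 1) :
    theta q (-1) ^ 2 = q * theta (q ^ 5) (-1) ^ 2 +
      4 * (theta (q ^ 5) (-q) * theta (q ^ 5) (-q ^ 2)) := by
  have hq5 : q ^ 5 ≠ 0 := pow_ne_zero _ hq
  have hq51 : ‖q ^ 5‖ < 1 := norm_pow_lt_one hq1 (by norm_num)
  have hz : ∀ k : ℤ, -q ^ k ≠ 0 := fun k => neg_ne_zero.2 (zpow_ne_zero _ hq)
  have n1 : (-1 : ℂ) ≠ 0 := by norm_num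
  have step : ∀ (r : Fin 5) (a b : ℤ) (e : ℕ),
      (∀ u v : ℤ, (u + 2 * v + (crossPoint r).1 - 1) * (u + 2 * v + (crossPoint r).1 - 1 - 1) +
        (v - 2 * u + (crossPoint r).2 + 1) * (v - 2 * u + (crossPoint r).2 + 1 - 1) =
        2 * e + (5 * (u * (u - 1)) + 2 * (a * u)) + (5 * (v * (v - 1)) + 2 * (b * v))) →
      ∑' p : ℤ × ℤ, thetaTerm q (-1) ((crossSplit (r, p)).1 - 1) *
        thetaTerm q (-1) ((crossSplit (r, p)).2 + 1) =
        q ^ e * (theta (q ^ 5) (-q ^ a) * theta (q ^ 5) (-q ^ b)) := by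
    intro r a b e h
    rw [theta_mul_theta_eq_tsum hq5 hq51 (hz a) hq5 hq51 (hz b), ← tsum_mul_left]
    refine tsum_congr fun ⟨u, v⟩ => ?_
    have t : ∀ x, thetaTerm q (-1) x = q ^ (x * (x - 1) / 2) := fun x => by
      have := thetaTerm_neg_zpow hq 1 0 x
      simpa using this
    rw [crossSplit_apply, t, t, thetaTerm_neg_zpow hq, thetaTerm_neg_zpow hq, ← zpow_add₀ hq,
      ← zpow_add₀ hq, ← zpow_natCast, ← zpow_add₀ hq]
    congr 1
    have h1 := two_mul_triangle (u + 2 * v + (crossPoint r).1 - 1)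
    have h2 := two_mul_triangle (v - 2 * u + (crossPoint r).2 + 1)
    have h3 := two_mul_triangle u
    have h4 := two_mul_triangle v
    have h5 := h u v
    push_cast
    linarith
  have hi : ∀ k : ℕ, theta (q ^ 5) (-q ^ (-(k : ℤ))) = theta (q ^ 5) (-q ^ (k : ℤ)) / q ^ k := by
    intro k
    rw [← theta_div hq5, show q ^ 5 / -q ^ (-(k : ℤ)) = q ^ 5 * -q ^ (k : ℤ) by
      rw [zpow_neg]; field_simp, theta_mul hq5 (hz _), zpow_natCast]
    field_simp
  have h1 := hi 1
  have h2 := hi 2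
  rw [Nat.cast_one] at h1
  rw [Nat.cast_ofNat] at h2
  rw [sq, theta_mul_theta_eq_tsum hq hq1 n1 hq hq1 n1,
    tsum_eq_sum_tsum_of_equiv (crossSplit.trans
      ((Equiv.subRight (1 : ℤ)).prodCongr (Equiv.addRight (1 : ℤ))))
      (summable_thetaTerm_mul hq hq1 n1 hq hq1 n1), Fin.sum_univ_five]
  simp only [Equiv.trans_apply, Equiv.prodCongr_apply, Prod.map, Equiv.subRight_apply,
    Equiv.coe_addRight]
  rw [step 0 0 0 1 (by intro u v; simp [crossPoint]; ring),
    step 1 1 2 0 (by intro u v; simp [crossPoint]; ring),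
    step 2 (-1) (-2) 3 (by intro u v; simp [crossPoint]; ring),
    step 3 (-2) 1 2 (by intro u v; simp [crossPoint]; ring),
    step 4 2 (-1) 1 (by intro u v; simp [crossPoint]; ring), h1, h2]
  simp only [pow_one, pow_zero, zpow_ofNat]
  field_simp
  ring

/-! ### Theta values as eta quotients, and the relation of level ten -/

theorem euler_eq_prod_poch {q : ℂ} (hq1 : ‖q‖ < 1) {m : ℕ} (hm : 0 < m) :
    euler q = ∏ r ∈ Finset.range m, poch (q ^ (r + 1)) (q ^ m) := by
  rw [euler, poch_eq_prod_poch q hq1 hm]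
  exact Finset.prod_congr rfl fun r _ => by rw [pow_succ']

theorem euler_pow_eq_prod_poch {q : ℂ} (hq1 : ‖q‖ < 1) {k m : ℕ} (hk : k ≠ 0) (hm : 0 < m) :
    euler (q ^ k) = ∏ r ∈ Finset.range m, poch (q ^ (k * (r + 1))) (q ^ (k * m)) := by
  rw [euler_eq_prod_poch (norm_pow_lt_one hq1 hk) hm]
  exact Finset.prod_congr rfl fun r _ => by rw [pow_mul, pow_mul]

theorem theta_pow {q : ℂ} (hq : q ≠ 0) (hq1 : ‖q‖ < 1) {m r s : ℕ} (h : r + s = m) (hm : m ≠ 0) :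
    theta (q ^ m) (q ^ r) = euler (q ^ m) * poch (q ^ r) (q ^ m) * poch (q ^ s) (q ^ m) := by
  rw [theta_eq_prod (pow_ne_zero _ hq) (norm_pow_lt_one hq1 hm) (pow_ne_zero _ hq)]
  congr 2
  rw [← h, pow_add]
  field_simp

theorem theta_neg_pow {q : ℂ} (hq : q ≠ 0) (hq1 : ‖q‖ < 1) {m r s : ℕ} (h : r + s = m)
    (hm : m ≠ 0) :
    theta (q ^ m) (-q ^ r) = euler (q ^ m) * poch (-q ^ r) (q ^ m) * poch (-q ^ s) (q ^ m) := by
  rw [theta_eq_prod (pow_ne_zero _ hq) (norm_pow_lt_one hq1 hm) (neg_ne_zero.2 (pow_ne_zero _ hq))]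
  congr 2
  rw [← h, pow_add]
  field_simp

theorem poch_pow_mul_poch_neg_pow {q : ℂ} (hq1 : ‖q‖ < 1) {m : ℕ} (r : ℕ) (hm : m ≠ 0) :
    poch (q ^ r) (q ^ m) * poch (-q ^ r) (q ^ m) = poch (q ^ (2 * r)) (q ^ (2 * m)) := by
  rw [poch_mul_poch_neg _ (norm_pow_lt_one hq1 hm), ← pow_mul, ← pow_mul, mul_comm r, mul_comm m]

/-- The theta value here is 2ψ(q); the next two lemmas treat φ(-q) and ψ(q). Each follows from the
triple product by regrouping factors by residue class. -/
theorem theta_neg_one_mul_euler {q : ℂ} (hq : q ≠ 0) (hq1 : ‖q‖ < 1) :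
    theta q (-1) * euler q = 2 * euler (q ^ 2) ^ 2 := by
  have h1 := theta_neg_pow hq hq1 (m := 1) (r := 0) (s := 1) rfl one_ne_zero
  have h2 := poch_pow_mul_poch_neg_pow hq1 (m := 1) 1 one_ne_zero
  have h3 := poch_eq_mul (-1) hq1
  simp only [pow_zero, pow_one, mul_one] at h1 h2
  rw [neg_one_mul] at h3
  rw [h1, h3]
  rw [← euler, ← euler] at h2
  linear_combination 2 * (euler (q ^ 2) + euler q * poch (-q) q) * h2

theorem theta_sq_self_mul_euler {q : ℂ} (hq : q ≠ 0) (hq1 : ‖q‖ < 1) :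
    theta (q ^ 2) q * euler (q ^ 2) = euler q ^ 2 := by
  have h1 := theta_pow hq hq1 (m := 2) (r := 1) (s := 1) rfl two_ne_zero
  have h2 := euler_eq_prod_poch hq1 (m := 2) two_pos
  simp only [Finset.prod_range_succ, Finset.prod_range_zero, pow_one, zero_add, one_mul,
    Nat.reduceAdd] at h1 h2
  rw [h1, h2, euler]
  ring

theorem theta_pow_four_mul_euler {q : ℂ} (hq : q ≠ 0) (hq1 : ‖q‖ < 1) :
    theta (q ^ 4) (-q) * euler q = euler (q ^ 2) ^ 2 := by
  have h1 := theta_neg_pow hq hq1 (m := 4) (r := 1) (s := 3) rfl (by norm_num)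
  have h2 := euler_eq_prod_poch hq1 (m := 4) (by norm_num)
  have h3 := euler_pow_eq_prod_poch hq1 (k := 2) (m := 4) two_ne_zero (by norm_num)
  have h4 := euler_pow_eq_prod_poch hq1 (k := 2) (m := 2) two_ne_zero (by norm_num)
  have h5 := euler_pow_eq_prod_poch hq1 (k := 4) (m := 2) (by norm_num) (by norm_num)
  have p1 := poch_pow_mul_poch_neg_pow hq1 (m := 4) 1 (by norm_num)
  have p3 := poch_pow_mul_poch_neg_pow hq1 (m := 4) 3 (by norm_num)
  simp only [Finset.prod_range_succ, Finset.prod_range_zero, pow_one, zero_add, one_mul,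
    Nat.reduceAdd, Nat.reduceMul, mul_one] at *
  calc _ = euler (q ^ 4) * (poch q (q ^ 4) * poch (-q) (q ^ 4)) *
        (poch (q ^ 3) (q ^ 4) * poch (-q ^ 3) (q ^ 4)) *
        (poch (q ^ 2) (q ^ 4) * poch (q ^ 4) (q ^ 4)) := by rw [h1, h2]; ring
    _ = euler (q ^ 2) ^ 2 := by
      rw [p1, p3, sq (euler _), ← h4]
      nth_rw 3 [h3]
      rw [h5]
      ring

theorem theta_pow_ten_mul_theta {q : ℂ} (hq : q ≠ 0) (hq1 : ‖q‖ < 1) :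
    theta (q ^ 10) q * theta (q ^ 10) (q ^ 3) * (euler (q ^ 2) * euler (q ^ 5)) =
      euler q * euler (q ^ 10) ^ 3 := by
  have h1 := theta_pow hq hq1 (m := 10) (r := 1) (s := 9) rfl (by norm_num)
  have h2 := theta_pow hq hq1 (m := 10) (r := 3) (s := 7) rfl (by norm_num)
  have h3 := euler_eq_prod_poch hq1 (m := 10) (by norm_num)
  have h4 := euler_pow_eq_prod_poch hq1 (k := 2) (m := 5) (by norm_num) (by norm_num)
  have h5 := euler_pow_eq_prod_poch hq1 (k := 5) (m := 2) (by norm_num) (by norm_num)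
  simp only [Finset.prod_range_succ, Finset.prod_range_zero, pow_one, zero_add, one_mul,
    Nat.reduceAdd, Nat.reduceMul, mul_one] at *
  rw [h1, h2, h3, h4, h5, show euler (q ^ 10) = poch (q ^ 10) (q ^ 10) from rfl]
  ring

theorem theta_pow_five_mul_theta {q : ℂ} (hq : q ≠ 0) (hq1 : ‖q‖ < 1) :
    theta (q ^ 5) q * theta (q ^ 5) (q ^ 2) = euler q * euler (q ^ 5) := by
  have h1 := theta_pow hq hq1 (m := 5) (r := 1) (s := 4) rfl (by norm_num)
  have h2 := theta_pow hq hq1 (m := 5) (r := 2) (s := 3) rfl (by norm_num)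
  have h3 := euler_eq_prod_poch hq1 (m := 5) (by norm_num)
  simp only [Finset.prod_range_succ, Finset.prod_range_zero, pow_one, zero_add, one_mul,
    Nat.reduceAdd] at *
  rw [h1, h2, h3, show euler (q ^ 5) = poch (q ^ 5) (q ^ 5) from rfl]
  ring

theorem theta_pow_five_neg_mul_theta {q : ℂ} (hq : q ≠ 0) (hq1 : ‖q‖ < 1) :
    theta (q ^ 5) (-q) * theta (q ^ 5) (-q ^ 2) * (euler q * euler (q ^ 10)) =
      euler (q ^ 2) * euler (q ^ 5) ^ 3 := by
  have h1 := theta_neg_pow hq hq1 (m := 5) (r := 1) (s := 4) rfl (by norm_num)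
  have h2 := theta_neg_pow hq hq1 (m := 5) (r := 2) (s := 3) rfl (by norm_num)
  have h3 := euler_eq_prod_poch hq1 (m := 5) (by norm_num)
  have h4 := euler_pow_eq_prod_poch hq1 (k := 2) (m := 5) (by norm_num) (by norm_num)
  have p1 := poch_pow_mul_poch_neg_pow hq1 (m := 5) 1 (by norm_num)
  have p2 := poch_pow_mul_poch_neg_pow hq1 (m := 5) 2 (by norm_num)
  have p3 := poch_pow_mul_poch_neg_pow hq1 (m := 5) 3 (by norm_num)
  have p4 := poch_pow_mul_poch_neg_pow hq1 (m := 5) 4 (by norm_num)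
  simp only [Finset.prod_range_succ, Finset.prod_range_zero, pow_one, zero_add, one_mul,
    Nat.reduceAdd, Nat.reduceMul, mul_one] at *
  rw [h1, h2, h3, h4, ← p1, ← p2, ← p3, ← p4,
    show euler (q ^ 5) = poch (q ^ 5) (q ^ 5) from rfl,
    show euler (q ^ 10) = poch (q ^ 10) (q ^ 10) from rfl]
  ring

/-- This is Ramanujan's ψ(q)² - qψ(q⁵)² = f(q, q⁴) f(q², q³), written in Euler products. -/
theorem euler_relation_psi {q : ℂ} (hq : q ≠ 0) (hq1 : ‖q‖ < 1) :
    euler (q ^ 2) ^ 4 / euler q ^ 2 = q * (euler (q ^ 10) ^ 4 / euler (q ^ 5) ^ 2) +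
      euler (q ^ 2) * euler (q ^ 5) ^ 3 / (euler q * euler (q ^ 10)) := by
  have h := theta_neg_one_sq hq hq1
  have h5 := theta_neg_one_mul_euler (pow_ne_zero 5 hq) (norm_pow_lt_one hq1 (by norm_num))
  rw [← pow_mul] at h5
  have e1 := euler_ne_zero hq1
  have e5 := euler_ne_zero (norm_pow_lt_one hq1 (k := 5) (by norm_num))
  have e10 := euler_ne_zero (norm_pow_lt_one hq1 (k := 10) (by norm_num))
  rw [eq_div_of_mul_eq e1 (theta_neg_one_mul_euler hq hq1), eq_div_of_mul_eq e5 h5,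
    eq_div_of_mul_eq (mul_ne_zero e1 e10) (theta_pow_five_neg_mul_theta hq hq1)] at h
  linear_combination h / 4

theorem euler_relation_phi {q : ℂ} (hq : q ≠ 0) (hq1 : ‖q‖ < 1) :
    euler q ^ 4 / euler (q ^ 2) ^ 2 = euler (q ^ 5) ^ 4 / euler (q ^ 10) ^ 2 -
      4 * q * (euler q * euler (q ^ 10) ^ 3 / (euler (q ^ 2) * euler (q ^ 5))) := by
  have h := theta_sq_self_sq hq hq1
  have h5 := theta_sq_self_mul_euler (pow_ne_zero 5 hq) (norm_pow_lt_one hq1 (by norm_num))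
  rw [← pow_mul] at h5
  have e2 := euler_ne_zero (norm_pow_lt_one hq1 (k := 2) (by norm_num))
  have e5 := euler_ne_zero (norm_pow_lt_one hq1 (k := 5) (by norm_num))
  have e10 := euler_ne_zero (norm_pow_lt_one hq1 (k := 10) (by norm_num))
  rw [eq_div_of_mul_eq e2 (theta_sq_self_mul_euler hq hq1), eq_div_of_mul_eq e10 h5,
    eq_div_of_mul_eq (mul_ne_zero e2 e5) (theta_pow_ten_mul_theta hq hq1)] at h
  linear_combination h

/-- The level ten relation behind the Lambert series of `ψ(q ^ 5) ^ 5 / ψ(q)`. -/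
theorem euler_relation_level_ten {q : ℂ} (hq : q ≠ 0) (hq1 : ‖q‖ < 1) :
    4 * q ^ 3 * (euler (q ^ 10) ^ 10 * euler q / (euler (q ^ 5) ^ 5 * euler (q ^ 2) ^ 2)) =
      q * euler (q ^ 5) ^ 5 / euler q - 3 * (q ^ 2 * euler (q ^ 10) ^ 5 / euler (q ^ 2)) +
      (euler q ^ 5 / euler (q ^ 5) - euler (q ^ 2) ^ 5 / euler (q ^ 10)) / 5 := by
  have h1 := euler_relation_psi hq hq1
  have h2 := euler_relation_phi hq hq1
  have e1 := euler_ne_zero hq1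
  have e2 := euler_ne_zero (norm_pow_lt_one hq1 (k := 2) (by norm_num))
  have e5 := euler_ne_zero (norm_pow_lt_one hq1 (k := 5) (by norm_num))
  have e10 := euler_ne_zero (norm_pow_lt_one hq1 (k := 10) (by norm_num))
  generalize euler q = a at *
  generalize euler (q ^ 2) = b at *
  generalize euler (q ^ 5) = c at *
  generalize euler (q ^ 10) = d at *
  -- This eta quotient parametrises level ten. The two quadratic relations say that t + 1 and t - 4
  -- are eta quotients too, so after division by q²d⁵/b every term is rational in t.
  obtain ⟨t, ht⟩ : ∃ t, t = b * c ^ 5 / (q * a * d ^ 5) := ⟨_, rfl⟩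
  have ht0 : t ≠ 0 := by rw [ht]; positivity
  have hs : b ^ 4 * c ^ 2 / (q * a ^ 2 * d ^ 4) = t + 1 := by
    have : b ^ 4 * c ^ 2 / (q * a ^ 2 * d ^ 4) = b ^ 4 / a ^ 2 * (c ^ 2 / (q * d ^ 4)) := by
      field_simp
    rw [this, h1, ht]
    field_simp
    ring
  have hw : a ^ 3 * c / (q * b * d ^ 3) = t - 4 := by
    have : a ^ 3 * c / (q * b * d ^ 3) = a ^ 4 / b ^ 2 * (b * c / (q * a * d ^ 3)) := by
      field_simp
    rw [this, h2, ht]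
    field_simp
  have k0 : 4 * q ^ 3 * (d ^ 10 * a / (c ^ 5 * b ^ 2)) = q ^ 2 * d ^ 5 / b * (4 / t) := by
    rw [ht]; field_simp
  have k1 : q * c ^ 5 / a = q ^ 2 * d ^ 5 / b * t := by
    rw [ht]; field_simp
  have k2 : a ^ 5 / c = q ^ 2 * d ^ 5 / b * ((t - 4) ^ 2 * (t + 1) / t) := by
    rw [← hs, ← hw, ht]; field_simp
  have k3 : b ^ 5 / d = q ^ 2 * d ^ 5 / b * ((t - 4) * (t + 1) ^ 2 / t) := by
    rw [← hs, ← hw, ht]; field_simp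
  rw [k0, k1, k2, k3]
  field_simp
  ring

/-! ### Lambert series twisted by the quadratic character modulo 5 -/

/-- The quadratic character modulo `5`. -/
def chi5 (n : ℕ) : ℤ :=
  if n % 5 = 1 ∨ n % 5 = 4 then 1 else if n % 5 = 2 ∨ n % 5 = 3 then -1 else 0

theorem chi5_add_mul (r n : ℕ) : chi5 (r + 5 * n) = chi5 r := by
  simp [chi5]

theorem abs_chi5_le_one (n : ℕ) : |chi5 n| ≤ 1 := by
  rw [chi5]; split_ifs <;> simp

theorem norm_chi5_mul_le (n e : ℕ) : ‖(chi5 n : ℂ) * e‖ ≤ e := by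
  have h : ‖(chi5 n : ℂ)‖ ≤ 1 := by
    rw [Complex.norm_intCast]; exact_mod_cast abs_chi5_le_one n
  rw [norm_mul, Complex.norm_natCast]
  exact mul_le_of_le_one_left (Nat.cast_nonneg e) h

/-- The divisor sum `∑ χ(d) (n / d)` over `d ∣ n`. -/
def twistedSigma (n : ℕ) : ℤ := ∑ p ∈ n.divisorsAntidiagonal, chi5 p.1 * p.2

/-- The divisor sum `∑ χ(n / d) (n / d)` over `d ∣ n`. -/
def twistedSigma' (n : ℕ) : ℤ := ∑ p ∈ n.divisorsAntidiagonal, chi5 p.2 * p.2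

theorem summable_mul_pow_mul {F : ℕ → ℕ → ℂ} (hF : ∀ d e, ‖F d e‖ ≤ e) {q : ℂ} (hq1 : ‖q‖ < 1) :
    Summable fun p : ℕ+ × ℕ+ => F p.1 p.2 * q ^ (p.1 * p.2 : ℕ) := by
  refine Summable.of_norm_bounded (summable_prod_mul_pow 1 hq1).norm fun p => ?_
  rw [norm_mul, norm_mul, pow_one, Complex.norm_natCast]
  gcongr
  exact hF _ _

theorem tsum_divisorSum_mul_pow {F : ℕ → ℕ → ℂ} (hF : ∀ d e, ‖F d e‖ ≤ e) {q : ℂ} (hq1 : ‖q‖ < 1) :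
    ∑' n : ℕ, (∑ p ∈ n.divisorsAntidiagonal, F p.1 p.2) * q ^ n =
      ∑' d : ℕ+, ∑' e : ℕ+, F d e * q ^ (d * e : ℕ) := by
  have hs := summable_mul_pow_mul hF hq1
  rw [← hs.tsum_prod, ← tsum_pnat_eq_tsum_of_eq_zero (by simp), ← sigmaAntidiagonalEquivProd.tsum_eq]
  refine Eq.trans ?_ (sigmaAntidiagonalEquivProd.summable_iff.2 hs).tsum_sigma.symm
  refine tsum_congr fun n => ?_
  rw [tsum_fintype, Finset.sum_mul, ← Finset.sum_attach, Finset.univ_eq_attach]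
  refine Finset.sum_congr rfl fun p _ => ?_
  have := (Nat.mem_divisorsAntidiagonal.1 p.2).1
  simp [sigmaAntidiagonalEquivProd, divisorsAntidiagonalFactors, this]

theorem tsum_pnat_mul_pow {x : ℂ} (hx : ‖x‖ < 1) :
    ∑' e : ℕ+, (e : ℂ) * x ^ (e : ℕ) = x / (1 - x) ^ 2 := by
  rw [tsum_pnat_eq_tsum_of_eq_zero (f := fun e : ℕ => (e : ℂ) * x ^ e) (by simp)]
  exact tsum_coe_mul_geometric_of_norm_lt_one hx

theorem tsum_twistedSigma {q : ℂ} (hq1 : ‖q‖ < 1) :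
    ∑' n : ℕ, (twistedSigma n : ℂ) * q ^ n = ∑' n : ℕ, chi5 n * (q ^ n / (1 - q ^ n) ^ 2) := by
  have h := tsum_divisorSum_mul_pow norm_chi5_mul_le hq1
  simp only [twistedSigma]
  push_cast
  rw [h, ← tsum_pnat_eq_tsum_of_eq_zero (f := fun n : ℕ => (chi5 n : ℂ) * (q ^ n / (1 - q ^ n) ^ 2))
    (by simp [chi5])]
  refine tsum_congr fun d => ?_
  rw [← tsum_pnat_mul_pow (norm_pow_lt_one hq1 d.ne_zero), ← tsum_mul_left]
  refine tsum_congr fun e => ?_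
  rw [pow_mul, mul_assoc]

/-- The residues 1 and 4 mod 5 assemble into the Weierstrass sum at q, and 2 and 3 into the one at
q², because q⁵/q = q⁴ and q⁵/q² = q³. -/
theorem tsum_twistedSigma_eq_wpSum {q : ℂ} (hq : q ≠ 0) (hq1 : ‖q‖ < 1) :
    ∑' n : ℕ, (twistedSigma n : ℂ) * q ^ n = wpSum (q ^ 5) q - wpSum (q ^ 5) (q ^ 2) := by
  have hs : Summable fun n : ℕ => (chi5 n : ℂ) * (q ^ n / (1 - q ^ n) ^ 2) := by
    refine Summable.of_norm_bounded (g := fun n : ℕ => ‖1 * q ^ n / (1 - 1 * q ^ n) ^ 2‖)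
      (summable_norm_div_one_sub_sq 1 hq1) fun n => ?_
    rw [one_mul, norm_mul, Complex.norm_intCast]
    exact mul_le_of_le_one_left (norm_nonneg _) (by exact_mod_cast abs_chi5_le_one n)
  rw [tsum_twistedSigma hq1, tsum_eq_sum_tsum_of_equiv
    ((Equiv.prodComm _ _).trans (Nat.divModEquiv 5).symm) hs]
  have h : ∀ (r : Fin 5) (n : ℕ),
      ((Equiv.prodComm _ _).trans (Nat.divModEquiv 5).symm) (r, n) = r + 5 * n := fun r n => by
    simp only [Equiv.trans_apply, Equiv.prodComm_apply, Prod.swap_prod_mk,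
      Nat.divModEquiv_symm_apply]
    ring
  simp only [h, chi5_add_mul, tsum_mul_left, Fin.sum_univ_five]
  have e1 : q ^ 5 / q = q ^ 4 := by field_simp
  have e2 : q ^ 5 / q ^ 2 = q ^ 3 := by field_simp
  simp only [wpSum, e1, e2, pow_add, pow_mul]
  simp [chi5]
  ring

theorem mul_pow_ne_one {x q : ℂ} (hx : ‖x‖ < 1) (hq1 : ‖q‖ < 1) (n : ℕ) : x * q ^ n ≠ 1 := by
  intro h
  have h1 : ‖x * q ^ n‖ < 1 := by
    rw [norm_mul, norm_pow]
    exact mul_lt_one_of_nonneg_of_lt_one_left (norm_nonneg _) hx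
      (pow_le_one₀ (norm_nonneg _) hq1.le)
  rw [h] at h1
  simp at h1

/-- The generating function of 5-cores as a Lambert series. -/
theorem tsum_twistedSigma_eq_euler {q : ℂ} (hq : q ≠ 0) (hq1 : ‖q‖ < 1) :
    ∑' n : ℕ, (twistedSigma n : ℂ) * q ^ n = q * euler (q ^ 5) ^ 5 / euler q := by
  have hq5 : q ^ 5 ≠ 0 := pow_ne_zero _ hq
  have hn : ∀ k : ℕ, k ≠ 0 → ‖q ^ k‖ < 1 := fun k hk => norm_pow_lt_one hq1 hk
  have e1 : q ^ 5 / q = q ^ 4 := by field_simp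
  have e2 : q ^ 5 / q ^ 2 = q ^ 3 := by field_simp
  rw [tsum_twistedSigma_eq_wpSum hq hq1, wpSum_sub_wpSum hq5 (hn 5 (by norm_num)) hq
    (mul_pow_ne_one hq1 (hn 5 (by norm_num)))
    (by rw [e1]; exact mul_pow_ne_one (hn 4 (by norm_num)) (hn 5 (by norm_num)))
    (pow_ne_zero 2 hq) (mul_pow_ne_one (hn 2 (by norm_num)) (hn 5 (by norm_num)))
    (by rw [e2]; exact mul_pow_ne_one (hn 3 (by norm_num)) (hn 5 (by norm_num)))]
  have t : theta (q ^ 5) (q * q ^ 2) = theta (q ^ 5) (q ^ 2) := by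
    rw [← theta_div hq5]; congr 1; field_simp
  have t' : theta (q ^ 5) (q ^ 2 / q) = theta (q ^ 5) q := by congr 1; field_simp
  rw [t, t', mul_comm (theta _ (q ^ 2)), theta_pow_five_mul_theta hq hq1]
  have := euler_ne_zero hq1
  have := euler_ne_zero (hn 5 (by norm_num))
  field_simp

/-! ### The complementary Eisenstein series at fifth roots of unity -/

/-- The quadratic Gauss sum modulo `5`. -/
theorem gaussSum_mul_chi5 {ζ : ℂ} (h5 : ζ ^ 5 = 1) (e : ℕ) :
    ζ ^ e + (ζ ^ 4) ^ e - (ζ ^ 2) ^ e - (ζ ^ 3) ^ e = (ζ + ζ ^ 4 - ζ ^ 2 - ζ ^ 3) * chi5 e := by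
  obtain ⟨r, n, hr, rfl⟩ : ∃ r n, r < 5 ∧ e = r + 5 * n :=
    ⟨e % 5, e / 5, Nat.mod_lt _ (by norm_num), (Nat.mod_add_div e 5).symm⟩
  have h : ∀ k : ℕ, (ζ ^ k) ^ (r + 5 * n) = (ζ ^ k) ^ r := fun k => by
    rw [pow_add, pow_mul, ← pow_mul ζ k 5, mul_comm k 5, pow_mul ζ 5 k, h5]; simp
  have h1 := h 1
  rw [pow_one] at h1
  rw [h1, h, h, h, chi5_add_mul]
  interval_cases r <;> simp [chi5]
  · linear_combination (ζ ^ 3 - ζ) * h5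
  · linear_combination (ζ ^ 7 + ζ ^ 2 - ζ - ζ ^ 4) * h5
  · linear_combination (ζ ^ 11 + ζ ^ 6 + ζ - ζ ^ 3 - ζ ^ 7 - ζ ^ 2) * h5

theorem div_pow_rootOfUnity {ζ : ℂ} (h5 : ζ ^ 5 = 1) (q : ℂ) {j k : ℕ} (h : j + k = 5) :
    q / ζ ^ j = ζ ^ k * q := by
  have hζ : ζ ≠ 0 := by rintro rfl; simp at h5
  rw [div_eq_iff (pow_ne_zero j hζ), mul_right_comm, ← pow_add, add_comm, h, h5, one_mul]

/-- Factor by factor this is the product of 1 - ζᵏx over k mod 5, equal to 1 - x⁵. -/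
theorem poch_rootsOfUnity {ζ : ℂ} (h5 : ζ ^ 5 = 1) (h : 1 + ζ + ζ ^ 2 + ζ ^ 3 + ζ ^ 4 = 0) {q : ℂ}
    (hq1 : ‖q‖ < 1) :
    poch (ζ * q) q * poch (ζ ^ 2 * q) q * poch (ζ ^ 3 * q) q * poch (ζ ^ 4 * q) q * euler q =
      euler (q ^ 5) := by
  have m := fun a => multipliable_poch a hq1
  rw [euler, euler]
  simp only [poch]
  rw [← (m _).tprod_mul (m _), ← ((m _).mul (m _)).tprod_mul (m _),
    ← (((m _).mul (m _)).mul (m _)).tprod_mul (m _),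
    ← ((((m _).mul (m _)).mul (m _)).mul (m _)).tprod_mul (m _)]
  refine tprod_congr fun n => ?_
  have e : q ^ 5 * (q ^ 5) ^ n = (q * q ^ n) ^ 5 := by rw [mul_pow, ← pow_mul, ← pow_mul, mul_comm n]
  rw [e]
  simp only [mul_assoc]
  generalize q * q ^ n = x
  have h1 : (1 - ζ * x) * (1 - ζ ^ 4 * x) = 1 - (ζ + ζ ^ 4) * x + x ^ 2 := by
    linear_combination x ^ 2 * h5
  have h2 : (1 - ζ ^ 2 * x) * (1 - ζ ^ 3 * x) = 1 + (1 + ζ + ζ ^ 4) * x + x ^ 2 := by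
    linear_combination x ^ 2 * h5 - x * h
  have h3 : (ζ + ζ ^ 4) ^ 2 = 1 - (ζ + ζ ^ 4) := by
    linear_combination (ζ ^ 3 + 2) * h5 + h
  calc _ = ((1 - ζ * x) * (1 - ζ ^ 4 * x)) * ((1 - ζ ^ 2 * x) * (1 - ζ ^ 3 * x)) * (1 - x) := by ring
    _ = _ := by rw [h1, h2]; linear_combination -x ^ 2 * (1 - x) * h3

/-- The n = 0 terms sit on the unit circle, where the geometric expansion fails, so they are kept as
constants. Expanding the rest, the four conjugates of ζ combine at the e-th power into the Gauss sum
times χ(e). -/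
theorem tsum_twistedSigma'_eq_wpSum {ζ : ℂ} (h5 : ζ ^ 5 = 1) {q : ℂ} (hq1 : ‖q‖ < 1) :
    wpSum q ζ - wpSum q (ζ ^ 2) = ζ / (1 - ζ) ^ 2 - ζ ^ 2 / (1 - ζ ^ 2) ^ 2 +
      (ζ + ζ ^ 4 - ζ ^ 2 - ζ ^ 3) * ∑' n : ℕ, (twistedSigma' n : ℂ) * q ^ n := by
  have hζ : ζ ≠ 0 := by rintro rfl; simp at h5
  have hζn : ‖ζ‖ = 1 := by
    have : ‖ζ‖ ^ 5 = 1 := by rw [← norm_pow, h5, norm_one]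
    exact (pow_eq_one_iff_of_nonneg (norm_nonneg _) (by norm_num)).1 this
  have hs := fun b => (summable_norm_div_one_sub_sq b hq1).of_norm
  have i1 : q / ζ = ζ ^ 4 * q := by simpa using div_pow_rootOfUnity h5 q (j := 1) (k := 4) rfl
  have i2 : q / ζ ^ 2 = ζ ^ 3 * q := div_pow_rootOfUnity h5 q rfl
  have h := tsum_divisorSum_mul_pow (F := fun _ e => (chi5 e : ℂ) * e)
    (fun _ e => norm_chi5_mul_le e e) hq1
  have hD : ∀ (k : ℕ) (d : ℕ+), ζ ^ k * q ^ (d : ℕ) / (1 - ζ ^ k * q ^ (d : ℕ)) ^ 2 =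
      ∑' e : ℕ, (e : ℂ) * (ζ ^ k * q ^ (d : ℕ)) ^ e ∧
      Summable fun e : ℕ => (e : ℂ) * (ζ ^ k * q ^ (d : ℕ)) ^ e := fun k d => by
    have : ‖ζ ^ k * q ^ (d : ℕ)‖ < 1 := by
      rw [norm_mul, norm_pow, hζn, one_pow, one_mul]; exact norm_pow_lt_one hq1 d.ne_zero
    exact ⟨(tsum_coe_mul_geometric_of_norm_lt_one this).symm,
      (hasSum_coe_mul_geometric_of_norm_lt_one this).summable⟩
  have hsucc : ∀ k : ℕ, ∑' n : ℕ, ζ ^ k * q * q ^ n / (1 - ζ ^ k * q * q ^ n) ^ 2 =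
      ∑' d : ℕ+, ζ ^ k * q ^ (d : ℕ) / (1 - ζ ^ k * q ^ (d : ℕ)) ^ 2 := fun k => by
    rw [tsum_pnat_eq_tsum_succ (f := fun d : ℕ => ζ ^ k * q ^ d / (1 - ζ ^ k * q ^ d) ^ 2)]
    simp only [pow_succ', mul_assoc]
  have hsum : ∀ k : ℕ, Summable fun d : ℕ+ =>
      ζ ^ k * q ^ (d : ℕ) / (1 - ζ ^ k * q ^ (d : ℕ)) ^ 2 := fun k =>
    (hs (ζ ^ k)).comp_injective PNat.coe_injective
  have h0 : ∀ b : ℂ, ∑' n : ℕ, b * q ^ n / (1 - b * q ^ n) ^ 2 = b / (1 - b) ^ 2 +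
      ∑' n : ℕ, b * q * q ^ n / (1 - b * q * q ^ n) ^ 2 := fun b => by
    rw [(hs b).tsum_eq_zero_add]
    simp only [pow_succ', pow_zero, mul_one, mul_assoc]
  have k1 := hsucc 1
  have s1 := hsum 1
  have hD1 := hD 1
  rw [pow_one] at k1 s1 hD1
  rw [wpSum, wpSum, i1, i2, h0 ζ, h0 (ζ ^ 2), k1, hsucc, hsucc, hsucc]
  have key : ∑' d : ℕ+, ζ * q ^ (d : ℕ) / (1 - ζ * q ^ (d : ℕ)) ^ 2 +
      ∑' d : ℕ+, ζ ^ 4 * q ^ (d : ℕ) / (1 - ζ ^ 4 * q ^ (d : ℕ)) ^ 2 -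
      ∑' d : ℕ+, ζ ^ 2 * q ^ (d : ℕ) / (1 - ζ ^ 2 * q ^ (d : ℕ)) ^ 2 -
      ∑' d : ℕ+, ζ ^ 3 * q ^ (d : ℕ) / (1 - ζ ^ 3 * q ^ (d : ℕ)) ^ 2 =
      (ζ + ζ ^ 4 - ζ ^ 2 - ζ ^ 3) * ∑' n : ℕ, (twistedSigma' n : ℂ) * q ^ n := by
    simp only [twistedSigma']
    push_cast
    rw [h, ← s1.tsum_add (hsum 4), ← (s1.add (hsum 4)).tsum_sub (hsum 2),
      ← ((s1.add (hsum 4)).sub (hsum 2)).tsum_sub (hsum 3), ← tsum_mul_left]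
    refine tsum_congr fun d => ?_
    have a1 := (hD1 d).2
    have a2 := (hD 2 d).2
    have a3 := (hD 3 d).2
    have a4 := (hD 4 d).2
    rw [(hD1 d).1, (hD 2 d).1, (hD 3 d).1, (hD 4 d).1, ← a1.tsum_add a4, ← (a1.add a4).tsum_sub a2,
      ← ((a1.add a4).sub a2).tsum_sub a3, ← tsum_mul_left,
      tsum_pnat_eq_tsum_of_eq_zero (f := fun e : ℕ =>
        (ζ + ζ ^ 4 - ζ ^ 2 - ζ ^ 3) * ((chi5 e : ℂ) * e * q ^ (d * e : ℕ))) (by simp)]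
    refine tsum_congr fun e => ?_
    have := gaussSum_mul_chi5 h5 e
    simp only [mul_pow, pow_mul]
    linear_combination (e : ℂ) * (q ^ (d : ℕ)) ^ e * this
  linear_combination key

/-- The Eisenstein series complementary to the generating function of 5-cores. -/
theorem tsum_twistedSigma'_eq_euler {q : ℂ} (hq : q ≠ 0) (hq1 : ‖q‖ < 1) :
    1 - 5 * ∑' n : ℕ, (twistedSigma' n : ℂ) * q ^ n = euler q ^ 5 / euler (q ^ 5) := by
  obtain ⟨ζ, hprim⟩ : ∃ ζ : ℂ, IsPrimitiveRoot ζ 5 :=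
    ⟨_, Complex.isPrimitiveRoot_exp 5 (by norm_num)⟩
  have h5 : ζ ^ 5 = 1 := hprim.pow_eq_one
  have h1 : ζ ≠ 1 := hprim.ne_one (by norm_num)
  have h2 : ζ ^ 2 ≠ 1 := hprim.pow_ne_one_of_pos_of_lt (by norm_num) (by norm_num)
  have h : 1 + ζ + ζ ^ 2 + ζ ^ 3 + ζ ^ 4 = 0 := by
    have : (ζ - 1) * (1 + ζ + ζ ^ 2 + ζ ^ 3 + ζ ^ 4) = 0 := by linear_combination h5
    exact (mul_eq_zero.1 this).resolve_left (sub_ne_zero.2 h1)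
  have hζ : ζ ≠ 0 := hprim.ne_zero (by norm_num)
  have hζn : ‖ζ‖ = 1 := hprim.norm'_eq_one (by norm_num)
  have hne : ∀ b : ℂ, b ≠ 1 → ‖b‖ = 1 → ∀ n : ℕ, b * q ^ n ≠ 1 := fun b hb hb1 n hn => by
    rcases Nat.eq_zero_or_pos n with rfl | hn0
    · simp [hb] at hn
    · have := norm_pow_lt_one hq1 hn0.ne'
      rw [← one_mul ‖q ^ n‖, ← hb1, ← norm_mul, hn, norm_one] at this
      exact this.ne' hb1
  have hn2 : ‖ζ ^ 2‖ = 1 := by rw [norm_pow, hζn, one_pow]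
  have hl : ∀ b : ℂ, ‖b‖ = 1 → ‖q / b‖ < 1 := fun b hb => by rw [norm_div, hb, div_one]; exact hq1
  have w := wpSum_sub_wpSum hq hq1 hζ (hne ζ h1 hζn) (mul_pow_ne_one (hl ζ hζn) hq1)
    (pow_ne_zero 2 hζ) (hne _ h2 hn2) (mul_pow_ne_one (hl _ hn2) hq1)
  rw [tsum_twistedSigma'_eq_wpSum h5 hq1] at w
  have t1 : theta q (ζ * ζ ^ 2) = -ζ ^ 3 * theta q (ζ ^ 2) := by
    have e : q / ζ ^ 2 = q * ζ ^ 3 := by rw [div_pow_rootOfUnity h5 q (k := 3) rfl, mul_comm]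
    have := theta_mul hq (pow_ne_zero 3 hζ)
    rw [← e, theta_div hq] at this
    rw [← pow_succ', this]
    field_simp
  have t2 : theta q (ζ ^ 2 / ζ) = theta q ζ := by congr 1; field_simp
  have e1 := euler_ne_zero hq1
  have e5 := euler_ne_zero (norm_pow_lt_one hq1 (k := 5) (by norm_num))
  have hz1 := theta_ne_zero hq hq1 hζ (hne ζ h1 hζn) (mul_pow_ne_one (hl ζ hζn) hq1)
  have hz2 := theta_ne_zero hq hq1 (pow_ne_zero 2 hζ) (hne _ h2 hn2) (mul_pow_ne_one (hl _ hn2) hq1)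
  have tt : theta q ζ * theta q (ζ ^ 2) = (1 - ζ) * (1 - ζ ^ 2) * (euler q * euler (q ^ 5)) := by
    have i1 : q / ζ = ζ ^ 4 * q := by simpa using div_pow_rootOfUnity h5 q (j := 1) (k := 4) rfl
    have i2 : q / ζ ^ 2 = ζ ^ 3 * q := div_pow_rootOfUnity h5 q rfl
    rw [theta_eq_prod hq hq1 hζ, theta_eq_prod hq hq1 (pow_ne_zero 2 hζ), i1, i2,
      poch_eq_mul ζ hq1, poch_eq_mul (ζ ^ 2) hq1, ← poch_rootsOfUnity h5 h hq1]
    ring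
  have hr : euler q ^ 6 * ζ * (theta q (ζ * ζ ^ 2) * theta q (ζ ^ 2 / ζ)) /
      (theta q ζ * theta q (ζ ^ 2)) ^ 2 = -ζ ^ 4 / ((1 - ζ) * (1 - ζ ^ 2)) *
      (euler q ^ 5 / euler (q ^ 5)) := by
    have : euler q ^ 6 * ζ * (theta q (ζ * ζ ^ 2) * theta q (ζ ^ 2 / ζ)) /
      (theta q ζ * theta q (ζ ^ 2)) ^ 2 = -ζ ^ 4 * euler q ^ 6 / (theta q ζ * theta q (ζ ^ 2)) := by
      rw [t1, t2]; field_simp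
    have h1' := sub_ne_zero.2 h1.symm
    have h2' := sub_ne_zero.2 h2.symm
    rw [this, tt]
    field_simp
  rw [hr] at w
  have h1' := sub_ne_zero.2 h1.symm
  have h2' := sub_ne_zero.2 h2.symm
  -- Multiplying `w` by the Gauss sum produces the factor 5 in front of the series, and by `hκ` it
  -- turns the constant term into -1.
  have hg : (ζ + ζ ^ 4 - ζ ^ 2 - ζ ^ 3) ^ 2 = 5 := by
    linear_combination (ζ ^ 3 - 2 * ζ ^ 2 - ζ + 4) * h5 - h
  have hk : ζ / (1 - ζ) ^ 2 - ζ ^ 2 / (1 - ζ ^ 2) ^ 2 = -ζ ^ 4 / ((1 - ζ) * (1 - ζ ^ 2)) := by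
    rw [div_sub_div _ _ (pow_ne_zero 2 h1') (pow_ne_zero 2 h2'),
      div_eq_div_iff (by positivity) (by positivity)]
    linear_combination (1 - ζ) ^ 3 * (1 - ζ ^ 2) * ζ * h
  have hκ : (ζ + ζ ^ 4 - ζ ^ 2 - ζ ^ 3) * (-ζ ^ 4 / ((1 - ζ) * (1 - ζ ^ 2))) = -1 := by
    field_simp
    linear_combination (ζ ^ 2 + ζ - 1 - ζ ^ 3) * h5
  rw [hk] at w
  linear_combination (-(ζ + ζ ^ 4 - ζ ^ 2 - ζ ^ 3)) * w + (∑' n : ℕ, (twistedSigma' n : ℂ) * q ^ n) * hg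
    + (1 - euler q ^ 5 / euler (q ^ 5)) * hκ

/-! ### From analytic identities to formal power series -/

/-- Absolute convergence of an integral power series on the open unit disc. -/
def AbsConv (F : PowerSeries ℤ) : Prop :=
  ∀ q : ℂ, ‖q‖ < 1 → Summable fun n : ℕ => ‖((PowerSeries.coeff n F : ℤ) : ℂ) * q ^ n‖

/-- The sum of an integral power series at a complex number. -/
noncomputable def evalSeries (q : ℂ) (F : PowerSeries ℤ) : ℂ :=
  ∑' n : ℕ, ((PowerSeries.coeff n F : ℤ) : ℂ) * q ^ n

theorem coeff_mul_mul_pow (F G : PowerSeries ℤ) (q : ℂ) (n : ℕ) :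
    ((PowerSeries.coeff n (F * G) : ℤ) : ℂ) * q ^ n = ∑ p ∈ Finset.HasAntidiagonal.antidiagonal n,
      ((PowerSeries.coeff p.1 F : ℤ) : ℂ) * q ^ p.1 * (((PowerSeries.coeff p.2 G : ℤ) : ℂ) * q ^ p.2) := by
  rw [PowerSeries.coeff_mul]
  push_cast
  rw [Finset.sum_mul]
  refine Finset.sum_congr rfl fun p hp => ?_
  rw [← Finset.HasAntidiagonal.mem_antidiagonal.1 hp, pow_add]
  ring

theorem AbsConv.mul {F G : PowerSeries ℤ} (hF : AbsConv F) (hG : AbsConv G) : AbsConv (F * G) := by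
  intro q hq
  refine (summable_norm_sum_mul_antidiagonal_of_summable_norm (hF q hq) (hG q hq)).congr fun n => ?_
  rw [coeff_mul_mul_pow]

theorem evalSeries_mul {F G : PowerSeries ℤ} (hF : AbsConv F) (hG : AbsConv G) {q : ℂ}
    (hq : ‖q‖ < 1) : evalSeries q (F * G) = evalSeries q F * evalSeries q G := by
  simp only [evalSeries, coeff_mul_mul_pow]
  exact (tsum_mul_tsum_eq_tsum_sum_antidiagonal_of_summable_norm (hF q hq) (hG q hq)).symm

theorem coeff_C_mul_X_pow_mul_pow (c : ℤ) (k n : ℕ) (q : ℂ) :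
    ((PowerSeries.coeff n (PowerSeries.C c * PowerSeries.X ^ k) : ℤ) : ℂ) * q ^ n =
      if n = k then c * q ^ k else 0 := by
  rw [PowerSeries.coeff_C_mul, PowerSeries.coeff_X_pow]
  split_ifs with h <;> simp [h]

theorem absConv_C_mul_X_pow (c : ℤ) (k : ℕ) : AbsConv (PowerSeries.C c * PowerSeries.X ^ k) := by
  intro q _
  simp_rw [coeff_C_mul_X_pow_mul_pow]
  exact summable_of_ne_finset_zero (s := {k}) fun n hn => by
    simp [Finset.mem_singleton.not.1 hn]

theorem evalSeries_C_mul_X_pow (c : ℤ) (k : ℕ) (q : ℂ) :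
    evalSeries q (PowerSeries.C c * PowerSeries.X ^ k) = c * q ^ k := by
  simp only [evalSeries, coeff_C_mul_X_pow_mul_pow, tsum_ite_eq]

theorem AbsConv.pow {F : PowerSeries ℤ} (hF : AbsConv F) (k : ℕ) : AbsConv (F ^ k) := by
  induction k with
  | zero => simpa using absConv_C_mul_X_pow 1 0
  | succ k ih => rw [pow_succ]; exact ih.mul hF

theorem evalSeries_pow {F : PowerSeries ℤ} (hF : AbsConv F) (k : ℕ) {q : ℂ} (hq : ‖q‖ < 1) :
    evalSeries q (F ^ k) = evalSeries q F ^ k := by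
  induction k with
  | zero => simpa using evalSeries_C_mul_X_pow 1 0 q
  | succ k ih => rw [pow_succ, evalSeries_mul (hF.pow k) hF hq, ih, pow_succ]

/-- By the identity theorem, agreement on the punctured disc suffices. The point q = 0 is left out
because the theta series uses integer powers of q. -/
theorem eq_of_evalSeries_eq {F G : PowerSeries ℤ} (hF : AbsConv F) (hG : AbsConv G)
    (h : ∀ q : ℂ, q ≠ 0 → ‖q‖ < 1 → evalSeries q F = evalSeries q G) : F = G := by
  set a : ℕ → ℂ := fun n => ((PowerSeries.coeff n F : ℤ) : ℂ) - ((PowerSeries.coeff n G : ℤ) : ℂ) with ha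
  set p : FormalMultilinearSeries ℂ ℂ ℂ := FormalMultilinearSeries.ofScalars ℂ a with hp
  have hsum : ∀ q : ℂ, ‖q‖ < 1 → Summable fun n => ‖a n * q ^ n‖ := fun q hq => by
    refine Summable.of_nonneg_of_le (fun _ => norm_nonneg _) (fun n => ?_) ((hF q hq).add (hG q hq))
    rw [ha, sub_mul]
    exact norm_sub_le _ _
  have hrad : 0 < p.radius := by
    have : ((1 / 2 : NNReal) : ENNReal) ≤ p.radius := by
      refine p.le_radius_of_summable_norm ?_
      refine (hsum (1 / 2) (by norm_num)).congr fun n => ?_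
      rw [hp, FormalMultilinearSeries.ofScalars_norm, norm_mul, norm_pow]
      simp
    exact lt_of_lt_of_le (by simp) this
  have hfp := (p.hasFPowerSeriesOnBall hrad).hasFPowerSeriesAt
  have hps : ∀ q : ℂ, ‖q‖ < 1 → p.sum q = evalSeries q F - evalSeries q G := fun q hq => by
    rw [evalSeries, evalSeries, ← (hF q hq).of_norm.tsum_sub (hG q hq).of_norm,
      FormalMultilinearSeries.sum]
    refine tsum_congr fun n => ?_
    simp [hp, FormalMultilinearSeries.ofScalars, ha, sub_mul]
  have hev : ∀ᶠ q in 𝓝[≠] (0 : ℂ), p.sum q = 0 := by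
    have : ∀ᶠ q : ℂ in 𝓝[≠] 0, ‖q‖ < 1 :=
      nhdsWithin_le_nhds (tendsto_norm_zero.eventually (gt_mem_nhds one_pos))
    filter_upwards [this, self_mem_nhdsWithin] with q hq h0
    rw [hps q hq, h q h0 hq, sub_self]
  have hev0 := hfp.analyticAt.frequently_zero_iff_eventually_zero.1 hev.frequently
  have hz : p = 0 := hfp.eq_zero_of_eventually hev0
  ext n
  have := congrArg (fun P : FormalMultilinearSeries ℂ ℂ ℂ => P.coeff n) hz
  simp only [hp, FormalMultilinearSeries.coeff_ofScalars] at this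
  have h0 : a n = 0 := by simpa [FormalMultilinearSeries.coeff] using this
  exact_mod_cast sub_eq_zero.1 h0

/-- Equal exponents at m and n force (m - n)(2(m + n) - 1) = 0, and the second factor is odd. Hence
each coefficient of ψ(-q^k) is a single sign or zero. -/
theorem psiNeg_exponent_injective {k : ℕ} (hk : 1 ≤ k) :
    Function.Injective fun m : ℤ => k * (2 * m ^ 2 - m).toNat := by
  intro m n h
  have h1 : (2 * m ^ 2 - m).toNat = (2 * n ^ 2 - n).toNat := Nat.eq_of_mul_eq_mul_left hk h
  have hpos : ∀ m : ℤ, 0 ≤ 2 * m ^ 2 - m := fun m => by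
    rcases le_or_gt m 0 with h | h <;> nlinarith
  have h2 : 2 * m ^ 2 - m = 2 * n ^ 2 - n := by
    rw [← Int.toNat_of_nonneg (hpos m), h1, Int.toNat_of_nonneg (hpos n)]
  have h3 : (m - n) * (2 * (m + n) - 1) = 0 := by linear_combination h2
  rcases mul_eq_zero.1 h3 with h | h <;> omega

theorem coeff_psiNeg_exponent {k : ℕ} (hk : 1 ≤ k) (m : ℤ) :
    PowerSeries.coeff (k * (2 * m ^ 2 - m).toNat) (psiNeg k) = (-1) ^ m.natAbs := by
  rw [psiNeg, ramanujanTheta, PowerSeries.coeff_mk, finsum_eq_single _ m]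
  · rw [psiNeg_term, PowerSeries.coeff_C_mul, PowerSeries.coeff_X_pow, if_pos rfl, mul_one]
  · intro n hn
    rw [psiNeg_term, PowerSeries.coeff_C_mul, PowerSeries.coeff_X_pow,
      if_neg fun h => hn (psiNeg_exponent_injective hk h).symm, mul_zero]

theorem coeff_psiNeg_eq_zero {k n : ℕ}
    (hn : n ∉ Set.range fun m : ℤ => k * (2 * m ^ 2 - m).toNat) :
    PowerSeries.coeff n (psiNeg k) = 0 := by
  rw [psiNeg, ramanujanTheta, PowerSeries.coeff_mk]
  refine finsum_eq_zero_of_forall_eq_zero fun m => ?_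
  rw [psiNeg_term, PowerSeries.coeff_C_mul, PowerSeries.coeff_X_pow,
    if_neg fun h => hn ⟨m, h.symm⟩, mul_zero]

theorem absConv_of_abs_coeff_le {F : PowerSeries ℤ} (C : ℤ)
    (h : ∀ n : ℕ, |PowerSeries.coeff n F| ≤ C * (n ^ 2 + 1)) : AbsConv F := by
  intro q hq
  have h1 := (summable_norm_pow_mul_geometric_of_norm_lt_one 2 hq).add
    (summable_geometric_of_norm_lt_one hq).norm
  refine Summable.of_nonneg_of_le (fun _ => norm_nonneg _) (fun n => ?_) (h1.mul_left (C : ℝ))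
  rw [norm_mul, norm_mul, Complex.norm_intCast, norm_pow, norm_pow, Complex.norm_natCast]
  have : |((PowerSeries.coeff n F : ℤ) : ℝ)| ≤ C * ((n : ℝ) ^ 2 + 1) := by exact_mod_cast h n
  calc _ ≤ C * ((n : ℝ) ^ 2 + 1) * ‖q‖ ^ n := by gcongr
    _ = _ := by ring

theorem absConv_psiNeg {k : ℕ} (hk : 1 ≤ k) : AbsConv (psiNeg k) := by
  refine absConv_of_abs_coeff_le 1 fun n => ?_
  by_cases hn : n ∈ Set.range fun m : ℤ => k * (2 * m ^ 2 - m).toNat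
  · obtain ⟨m, rfl⟩ := hn
    simp only [coeff_psiNeg_exponent hk, abs_pow, abs_neg, abs_one, one_pow]
    linarith [sq_nonneg ((k * (2 * m ^ 2 - m).toNat : ℕ) : ℤ)]
  · rw [coeff_psiNeg_eq_zero hn, abs_zero]
    positivity

theorem evalSeries_psiNeg {k : ℕ} (hk : 1 ≤ k) {q : ℂ} (hq : q ≠ 0) :
    evalSeries q (psiNeg k) = theta (q ^ (4 * k)) (q ^ k) := by
  rw [evalSeries, theta, ← (psiNeg_exponent_injective hk).tsum_eq]
  · refine tsum_congr fun m => ?_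
    rw [coeff_psiNeg_exponent hk, thetaTerm, ← zpow_natCast q (4 * k), ← zpow_natCast q k,
      ← zpow_mul, ← zpow_mul, mul_assoc, ← zpow_add₀ hq, ← zpow_natCast]
    have hpos : 0 ≤ 2 * m ^ 2 - m := by rcases le_or_gt m 0 with h | h <;> nlinarith
    have e : ((4 * k : ℕ) : ℤ) * (m * (m - 1) / 2) + k * m =
        ((k * (2 * m ^ 2 - m).toNat : ℕ) : ℤ) := by
      push_cast
      rw [Int.toNat_of_nonneg hpos]
      linear_combination 2 * (k : ℤ) * two_mul_triangle m
    have s : (((-1) ^ m.natAbs : ℤ) : ℂ) = (-1) ^ m := by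
      push_cast
      rcases m.natAbs_eq with h | h
      · conv_rhs => rw [h, zpow_natCast]
      · conv_rhs => rw [h, zpow_neg, zpow_natCast, ← inv_pow]
        norm_num
    rw [e, s]
  · intro n hn
    by_contra h
    exact hn (by simp [coeff_psiNeg_eq_zero h])

theorem abs_twistedSigma_le (n : ℕ) : |twistedSigma n| ≤ n ^ 2 ∧ |twistedSigma' n| ≤ n ^ 2 := by
  have h : ∀ f : ℕ × ℕ → ℕ, |∑ p ∈ n.divisorsAntidiagonal, chi5 (f p) * (p.2 : ℤ)| ≤ n ^ 2 := by
    intro f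
    calc _ ≤ ∑ p ∈ n.divisorsAntidiagonal, |chi5 (f p) * (p.2 : ℤ)| := Finset.abs_sum_le_sum_abs _ _
      _ ≤ ∑ p ∈ n.divisorsAntidiagonal, (n : ℤ) := by
        refine Finset.sum_le_sum fun p hp => ?_
        rw [abs_mul, Nat.abs_cast]
        refine (mul_le_of_le_one_left (Nat.cast_nonneg _) (abs_chi5_le_one _)).trans ?_
        exact_mod_cast Nat.divisor_le (Nat.snd_mem_divisors_of_mem_antidiagonal hp)
      _ ≤ n * n := by
        rw [Finset.sum_const, nsmul_eq_mul]
        gcongr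
        rw [← Nat.map_div_right_divisors, Finset.card_map]
        exact Nat.card_divisors_le_self n
      _ = _ := by ring
  exact ⟨h fun p => p.1, h fun p => p.2⟩

/-! ### The Lambert series of ψ(q⁵)⁵/ψ(q) -/

/-- The coefficients of the Lambert series attached to `ψ(q ^ 5) ^ 5 / ψ(q)`. -/
def lambertCoeff (n : ℕ) : ℤ := twistedSigma n - twistedSigma' n -
  if 2 ∣ n then 3 * twistedSigma (n / 2) - twistedSigma' (n / 2) else 0

theorem abs_lambertCoeff_le (n : ℕ) : |lambertCoeff n| ≤ 6 * n ^ 2 := by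
  obtain ⟨h1, h2⟩ := abs_twistedSigma_le n
  obtain ⟨h3, h4⟩ := abs_twistedSigma_le (n / 2)
  have h5 : ((n / 2 : ℕ) : ℤ) ^ 2 ≤ (n : ℤ) ^ 2 := by
    gcongr
    exact Nat.div_le_self n 2
  rw [abs_le] at *
  rw [lambertCoeff]
  split_ifs <;> constructor <;> linarith [sq_nonneg (n : ℤ)]

theorem absConv_of_abs_le_sq {a : ℕ → ℤ} (C : ℤ) (h : ∀ n : ℕ, |a n| ≤ C * n ^ 2) :
    AbsConv (PowerSeries.mk a) := by
  have hC : 0 ≤ C := by simpa using (abs_nonneg _).trans (h 1)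
  refine absConv_of_abs_coeff_le C fun n => ?_
  rw [PowerSeries.coeff_mk]
  linarith [h n]

theorem tsum_lambertCoeff {q : ℂ} (hq1 : ‖q‖ < 1) :
    ∑' n : ℕ, (lambertCoeff n : ℂ) * q ^ n =
      ∑' n : ℕ, (twistedSigma n : ℂ) * q ^ n - ∑' n : ℕ, (twistedSigma' n : ℂ) * q ^ n -
      (3 * ∑' n : ℕ, (twistedSigma n : ℂ) * (q ^ 2) ^ n -
        ∑' n : ℕ, (twistedSigma' n : ℂ) * (q ^ 2) ^ n) := by
  have s : ∀ x : ℂ, ‖x‖ < 1 → Summable (fun n : ℕ => (twistedSigma n : ℂ) * x ^ n) ∧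
      Summable fun n : ℕ => (twistedSigma' n : ℂ) * x ^ n := fun x hx => by
    have h1 := (absConv_of_abs_le_sq (a := twistedSigma) 1
      fun n => by simpa using (abs_twistedSigma_le n).1) x hx
    have h2 := (absConv_of_abs_le_sq (a := twistedSigma') 1
      fun n => by simpa using (abs_twistedSigma_le n).2) x hx
    simp only [PowerSeries.coeff_mk] at h1 h2
    exact ⟨h1.of_norm, h2.of_norm⟩
  obtain ⟨s1, s2⟩ := s q hq1
  obtain ⟨s3, s4⟩ := s (q ^ 2) (norm_pow_lt_one hq1 two_ne_zero)
  have hinj : Function.Injective fun n : ℕ => 2 * n := fun m n h => Nat.eq_of_mul_eq_mul_left two_pos h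
  have h := (s3.hasSum.mul_left 3).sub s4.hasSum
  have h' : HasSum (fun n : ℕ => ((if 2 ∣ n then 3 * twistedSigma (n / 2) - twistedSigma' (n / 2)
      else 0 : ℤ) : ℂ) * q ^ n) _ := (hinj.hasSum_iff (fun n hn => by
        rw [if_neg fun hd => hn ⟨n / 2, Nat.mul_div_cancel' hd⟩]; simp)).1
      (h.congr_fun fun n => by
        simp only [Function.comp, dvd_mul_right, if_true, Nat.mul_div_cancel_left n two_pos, pow_mul]
        push_cast
        ring)
  rw [← h'.tsum_eq, ← s1.tsum_sub s2, ← (s1.sub s2).tsum_sub h'.summable]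
  refine tsum_congr fun n => ?_
  rw [lambertCoeff]
  push_cast
  ring

theorem tsum_lambertCoeff_eq_euler {q : ℂ} (hq : q ≠ 0) (hq1 : ‖q‖ < 1) :
    ∑' n : ℕ, (lambertCoeff n : ℂ) * q ^ n = 4 * q ^ 3 *
      (euler (q ^ 10) ^ 10 * euler q / (euler (q ^ 5) ^ 5 * euler (q ^ 2) ^ 2)) := by
  have h1 := tsum_twistedSigma_eq_euler hq hq1
  have h2 := tsum_twistedSigma'_eq_euler hq hq1
  have h3 := tsum_twistedSigma_eq_euler (pow_ne_zero 2 hq) (norm_pow_lt_one hq1 two_ne_zero)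
  have h4 := tsum_twistedSigma'_eq_euler (pow_ne_zero 2 hq) (norm_pow_lt_one hq1 two_ne_zero)
  rw [← pow_mul] at h3 h4
  rw [tsum_lambertCoeff hq1, euler_relation_level_ten hq hq1]
  linear_combination h1 + h2 / 5 - 3 * h3 - h4 / 5

/-- The denominator is cleared so that convergence of the inverse series is never needed. -/
theorem psiNeg_pow_five_identity :
    PowerSeries.C (-4 : ℤ) * PowerSeries.X ^ 3 * psiNeg 5 ^ 5 =
      psiNeg 1 * PowerSeries.mk fun n => (-1) ^ n * lambertCoeff n := by
  have a1 := absConv_psiNeg (k := 1) le_rfl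
  have a5 := absConv_psiNeg (k := 5) (by norm_num)
  have aX := absConv_C_mul_X_pow (-4) 3
  have aL := absConv_of_abs_le_sq (a := fun n => (-1) ^ n * lambertCoeff n) 6 fun n => by
    rw [abs_mul, abs_pow, abs_neg, abs_one, one_pow, one_mul]
    exact abs_lambertCoeff_le n
  refine eq_of_evalSeries_eq (aX.mul (a5.pow 5)) (a1.mul aL) fun q hq hq1 => ?_
  rw [evalSeries_mul aX (a5.pow 5) hq1, evalSeries_mul a1 aL hq1, evalSeries_C_mul_X_pow,
    evalSeries_pow a5 5 hq1, evalSeries_psiNeg le_rfl hq, evalSeries_psiNeg (by norm_num) hq]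
  -- At q = -p the series ψ(-q) becomes ψ(p), which the eta quotients describe, and the signs (-1)^n
  -- cancel.
  obtain ⟨p, rfl⟩ : ∃ p, q = -p := ⟨-q, (neg_neg q).symm⟩
  rw [norm_neg] at hq1
  have hp : p ≠ 0 := neg_ne_zero.1 hq
  have hL : evalSeries (-p) (PowerSeries.mk fun n => (-1) ^ n * lambertCoeff n) =
      ∑' n : ℕ, (lambertCoeff n : ℂ) * p ^ n := by
    rw [evalSeries]
    refine tsum_congr fun n => ?_
    rw [PowerSeries.coeff_mk, neg_pow]
    push_cast
    have : (-1 : ℂ) ^ n * (-1) ^ n = 1 := by rw [← mul_pow]; norm_num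
    linear_combination (lambertCoeff n : ℂ) * p ^ n * this
  have t1 := theta_pow_four_mul_euler hp hq1
  have t5 := theta_pow_four_mul_euler (pow_ne_zero 5 hp) (norm_pow_lt_one hq1 (by norm_num))
  rw [← pow_mul, ← pow_mul] at t5
  have e1 := euler_ne_zero hq1
  have e2 := euler_ne_zero (norm_pow_lt_one hq1 (k := 2) (by norm_num))
  have e5 := euler_ne_zero (norm_pow_lt_one hq1 (k := 5) (by norm_num))
  have i1 : (-p) ^ (4 * 1) = p ^ 4 := by ring
  have i5 : (-p) ^ (4 * 5) = p ^ (5 * 4) := by ring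
  have j5 : (-p) ^ 5 = -p ^ 5 := by ring
  rw [hL, tsum_lambertCoeff_eq_euler hp hq1, i1, i5, pow_one, j5, eq_div_of_mul_eq e1 t1,
    eq_div_of_mul_eq e5 t5]
  push_cast
  field_simp

theorem four_mul_bBar5 (n : ℕ) : 4 * bBar5 n = (-1) ^ n * lambertCoeff (n + 3) := by
  have h : (PowerSeries.X : PowerSeries ℤ) ^ 3 * (PowerSeries.C (-4) * (psiNeg 5 ^ 5 * psiNegInv)) =
      PowerSeries.mk fun n => (-1) ^ n * lambertCoeff n := by
    linear_combination psiNegInv * psiNeg_pow_five_identity +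
      (PowerSeries.mk fun n => (-1) ^ n * lambertCoeff n) * psiNeg_mul_psiNegInv
  have := congrArg (PowerSeries.coeff (n + 3)) h
  rw [PowerSeries.coeff_X_pow_mul, PowerSeries.coeff_C_mul, PowerSeries.coeff_mk, ← bBar5,
    pow_add] at this
  linarith

/-! ### Multiplicativity and size of the divisor sums -/

theorem chi5_mul (m n : ℕ) : chi5 (m * n) = chi5 m * chi5 n := by
  have h : (m * n) % 5 = (m % 5) * (n % 5) % 5 := Nat.mul_mod m n 5
  have hm : m % 5 < 5 := Nat.mod_lt _ (by norm_num)
  have hn : n % 5 < 5 := Nat.mod_lt _ (by norm_num)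
  simp only [chi5, h]
  generalize m % 5 = a at *
  generalize n % 5 = b at *
  interval_cases a <;> interval_cases b <;> rfl

theorem chi5_pow (m k : ℕ) : chi5 (m ^ k) = chi5 m ^ k := by
  induction k with
  | zero => simp [chi5]
  | succ k ih => rw [pow_succ, chi5_mul, ih, pow_succ]

theorem chi5_mul_self {n : ℕ} (h : ¬5 ∣ n) : chi5 n * chi5 n = 1 := by
  rw [chi5]
  split_ifs <;> first | rfl | omega

/-- The quadratic character modulo `5` as an arithmetic function. -/
def chi5Function : ArithmeticFunction ℤ := ⟨chi5, rfl⟩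

theorem isMultiplicative_chi5Function : chi5Function.IsMultiplicative :=
  ⟨rfl, fun {m n} _ => chi5_mul m n⟩

/-- The identity as an integer-valued arithmetic function. -/
def intId : ArithmeticFunction ℤ := ⟨fun n => n, rfl⟩

theorem isMultiplicative_intId : intId.IsMultiplicative := ⟨rfl, fun {m n} _ => Nat.cast_mul m n⟩

/-- The constant one away from zero, as an integer-valued arithmetic function. -/
def intOne : ArithmeticFunction ℤ := ⟨fun n => if n = 0 then 0 else 1, rfl⟩

theorem isMultiplicative_intOne : intOne.IsMultiplicative := by
  refine ⟨rfl, fun {m n} _ => ?_⟩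
  simp only [intOne, ArithmeticFunction.coe_mk, mul_eq_zero]
  split_ifs <;> simp_all

theorem twistedSigma_mul {m n : ℕ} (h : m.Coprime n) :
    twistedSigma (m * n) = twistedSigma m * twistedSigma n := by
  have := (isMultiplicative_chi5Function.mul isMultiplicative_intId).map_mul_of_coprime h
  rwa [ArithmeticFunction.mul_apply, ArithmeticFunction.mul_apply, ArithmeticFunction.mul_apply]
    at this

theorem twistedSigma'_eq (n : ℕ) :
    twistedSigma' n = (intOne * (chi5Function.pmul intId)) n := by
  rw [twistedSigma', ArithmeticFunction.mul_apply]
  refine Finset.sum_congr rfl fun p hp => ?_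
  have : p.1 ≠ 0 := Nat.ne_zero_of_mem_divisorsAntidiagonal hp |>.1
  rw [ArithmeticFunction.pmul_apply, show intOne p.1 = 1 from if_neg this, one_mul]
  rfl

theorem twistedSigma'_mul {m n : ℕ} (h : m.Coprime n) :
    twistedSigma' (m * n) = twistedSigma' m * twistedSigma' n := by
  simp only [twistedSigma'_eq]
  exact (isMultiplicative_intOne.mul
    (isMultiplicative_chi5Function.pmul isMultiplicative_intId)).map_mul_of_coprime h

theorem twistedSigma_prime_pow {p : ℕ} (hp : p.Prime) (k : ℕ) :
    twistedSigma (p ^ k) = ∑ i ∈ Finset.range (k + 1), chi5 p ^ (k - i) * (p : ℤ) ^ i := by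
  rw [twistedSigma, Nat.sum_divisorsAntidiagonal' (f := fun d e => chi5 d * (e : ℤ)),
    Nat.sum_divisors_prime_pow hp]
  refine Finset.sum_congr rfl fun i hi => ?_
  rw [Nat.pow_div (Nat.lt_succ_iff.1 (Finset.mem_range.1 hi)) hp.pos, chi5_pow, Nat.cast_pow]

theorem twistedSigma'_prime_pow {p : ℕ} (hp : p.Prime) (k : ℕ) :
    twistedSigma' (p ^ k) = ∑ i ∈ Finset.range (k + 1), chi5 p ^ i * (p : ℤ) ^ i := by
  rw [twistedSigma', Nat.sum_divisorsAntidiagonal' (f := fun _ e => chi5 e * (e : ℤ)),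
    Nat.sum_divisors_prime_pow hp]
  exact Finset.sum_congr rfl fun i _ => by rw [chi5_pow, Nat.cast_pow]

theorem twistedSigma_prime_pow_succ {p : ℕ} (hp : p.Prime) (k : ℕ) :
    twistedSigma (p ^ (k + 1)) = chi5 p * twistedSigma (p ^ k) + (p : ℤ) ^ (k + 1) := by
  rw [twistedSigma_prime_pow hp, twistedSigma_prime_pow hp, Finset.sum_range_succ, Finset.mul_sum,
    Nat.sub_self, pow_zero, one_mul]
  congr 1
  refine Finset.sum_congr rfl fun i hi => ?_
  rw [Nat.succ_sub (Nat.lt_succ_iff.1 (Finset.mem_range.1 hi)), pow_succ']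
  ring

theorem twistedSigma_one : twistedSigma 1 = 1 := rfl

/-- The upper bound carries the induction: as χ(p) may be -1, positivity at p^(k+1) needs σ(p^k) <
p^(k+1), and p ≥ 2 propagates that bound. -/
theorem twistedSigma_prime_pow_bounds {p : ℕ} (hp : p.Prime) (k : ℕ) :
    0 < twistedSigma (p ^ k) ∧ twistedSigma (p ^ k) < (p : ℤ) ^ (k + 1) := by
  have h2 : (2 : ℤ) ≤ p := by exact_mod_cast hp.two_le
  induction k with
  | zero =>
    rw [pow_zero, twistedSigma_one, zero_add, pow_one]
    constructor <;> linarith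
  | succ k ih =>
    obtain ⟨h1, h3⟩ := ih
    have h5 : 2 * (p : ℤ) ^ (k + 1) ≤ (p : ℤ) ^ (k + 1 + 1) := by
      rw [pow_succ' _ (k + 1)]; gcongr
    rw [twistedSigma_prime_pow_succ hp]
    have h4 := abs_le.1 (abs_chi5_le_one p)
    constructor <;> nlinarith

theorem twistedSigma_pos {n : ℕ} (hn : n ≠ 0) : 0 < twistedSigma n := by
  induction n using Nat.recOnPosPrimePosCoprime with
  | prime_pow p k hp _ => exact (twistedSigma_prime_pow_bounds hp k).1
  | zero => exact absurd rfl hn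
  | one => exact one_pos
  | coprime a b ha hb hab iha ihb =>
    rw [twistedSigma_mul hab]
    exact mul_pos (iha (by omega)) (ihb (by omega))

/-- For n = de prime to 5, χ(d)² = 1 gives χ(e) = χ(n)χ(d). -/
theorem twistedSigma'_eq_chi5_mul {n : ℕ} (h : ¬5 ∣ n) :
    twistedSigma' n = chi5 n * twistedSigma n := by
  rw [twistedSigma', twistedSigma, Finset.mul_sum]
  refine Finset.sum_congr rfl fun p hp => ?_
  have hm := (Nat.mem_divisorsAntidiagonal.1 hp).1
  have h1 : chi5 p.1 * chi5 p.1 = 1 := chi5_mul_self fun hd => h (hm ▸ hd.mul_right _)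
  rw [← hm, chi5_mul]
  linear_combination -(chi5 p.2 * (p.2 : ℤ)) * h1

/-- Since χ(5) = 0, the 5-part 5^k contributes 5^k to σ but only 1 to σ'. On the part prime to 5 the
two sums differ at most by the factor χ. -/
theorem twistedSigma'_lt_of_five_dvd {n : ℕ} (hn : n ≠ 0) (h : 5 ∣ n) :
    twistedSigma' n < twistedSigma n := by
  obtain ⟨k, m, hm, rfl⟩ := Nat.exists_eq_pow_mul_and_not_dvd hn 5 (by norm_num)
  have hp : Nat.Prime 5 := by norm_num
  have hk : k ≠ 0 := by rintro rfl; simp [hm] at h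
  have hco : (5 ^ k).Coprime m := ((Nat.Prime.coprime_iff_not_dvd hp).2 hm).pow_left k
  have h0 : chi5 5 = 0 := rfl
  have h1 : twistedSigma (5 ^ k) = 5 ^ k := by
    obtain ⟨j, rfl⟩ := Nat.exists_eq_succ_of_ne_zero hk
    rw [Nat.succ_eq_add_one, twistedSigma_prime_pow_succ hp, h0]
    simp
  have h2 : twistedSigma' (5 ^ k) = 1 := by
    rw [twistedSigma'_prime_pow hp, Finset.sum_eq_single 0] <;> simp +contextual [h0]
  rw [twistedSigma_mul hco, twistedSigma'_mul hco, h1, h2, twistedSigma'_eq_chi5_mul hm]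
  have h3 := twistedSigma_pos (n := m) (by rintro rfl; simp at hm)
  have h4 := abs_le.1 (abs_chi5_le_one m)
  have h5 : (1 : ℤ) < 5 ^ k := one_lt_pow₀ (by norm_num) hk
  nlinarith

theorem twistedSigma_two_mul_of_odd {n : ℕ} (h : ¬2 ∣ n) :
    twistedSigma (2 * n) = twistedSigma n ∧ twistedSigma' (2 * n) = -twistedSigma' n := by
  have hco : Nat.Coprime 2 n := (Nat.Prime.coprime_iff_not_dvd Nat.prime_two).2 h
  have h1 : twistedSigma 2 = 1 := by decide
  have h2 : twistedSigma' 2 = -1 := by decide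
  rw [twistedSigma_mul hco, twistedSigma'_mul hco, h1, h2]
  constructor <;> ring

/-- As χ(2) = -1, the recurrence at 2 reads σ(2^(k+1)) + σ(2^k) = 2^(k+1). Comparing consecutive k
eliminates the power of 2. -/
theorem twistedSigma_four_mul {n : ℕ} (hn : n ≠ 0) :
    twistedSigma (2 * (2 * n)) = twistedSigma (2 * n) + 2 * twistedSigma n := by
  obtain ⟨k, m, hm, rfl⟩ := Nat.exists_eq_pow_mul_and_not_dvd hn 2 (by norm_num)
  have hco : ∀ j, (2 ^ j).Coprime m := fun j =>
    ((Nat.Prime.coprime_iff_not_dvd Nat.prime_two).2 hm).pow_left j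
  rw [← mul_assoc 2 (2 ^ k), ← pow_succ', ← mul_assoc 2 (2 ^ (k + 1)), ← pow_succ', twistedSigma_mul (hco _),
    twistedSigma_mul (hco _), twistedSigma_mul (hco _), twistedSigma_prime_pow_succ Nat.prime_two,
    twistedSigma_prime_pow_succ Nat.prime_two, show chi5 2 = -1 from rfl]
  push_cast
  ring

/-! ### Signs of the coefficients by residue modulo 20 -/

theorem lambertCoeff_of_odd {n : ℕ} (h : ¬2 ∣ n) :
    lambertCoeff n = twistedSigma n - twistedSigma' n := by
  rw [lambertCoeff, if_neg h, sub_zero]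

theorem lambertCoeff_two_mul (n : ℕ) : lambertCoeff (2 * n) =
    twistedSigma (2 * n) - twistedSigma' (2 * n) - (3 * twistedSigma n - twistedSigma' n) := by
  rw [lambertCoeff, if_pos (dvd_mul_right 2 n), Nat.mul_div_cancel_left n two_pos]

theorem lambertCoeff_two_mul_of_odd {n : ℕ} (h : ¬2 ∣ n) :
    lambertCoeff (2 * n) = -2 * (twistedSigma n - twistedSigma' n) := by
  obtain ⟨h1, h2⟩ := twistedSigma_two_mul_of_odd h
  rw [lambertCoeff_two_mul, h1, h2]
  ring

/-- For χ(n) = 1 only the negative term survives, for χ(n) = -1 only the positive one, so the sign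
is visible. -/
theorem lambertCoeff_four_mul {n : ℕ} (hn : n ≠ 0) (h : ¬5 ∣ n) :
    lambertCoeff (2 * (2 * n)) = 2 * (1 - chi5 n) * twistedSigma n -
      2 * (1 + chi5 n) * twistedSigma (2 * n) := by
  have h2 : ¬5 ∣ 2 * n := by omega
  have h4 : ¬5 ∣ 2 * (2 * n) := by omega
  rw [lambertCoeff_two_mul, twistedSigma'_eq_chi5_mul h2, twistedSigma'_eq_chi5_mul h4, chi5_mul,
    chi5_mul, twistedSigma_four_mul hn, show chi5 2 = -1 from rfl]
  ring

theorem twistedSigma_sub_eq_zero {n : ℕ} (h : n % 5 = 1 ∨ n % 5 = 4) :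
    twistedSigma n - twistedSigma' n = 0 := by
  rw [twistedSigma'_eq_chi5_mul (by omega), chi5, if_pos h]
  ring

theorem twistedSigma_sub_pos {n : ℕ} (hn : n ≠ 0) (h : ¬(n % 5 = 1 ∨ n % 5 = 4)) :
    0 < twistedSigma n - twistedSigma' n := by
  by_cases h5 : 5 ∣ n
  · exact sub_pos.2 (twistedSigma'_lt_of_five_dvd hn h5)
  · have := twistedSigma_pos hn
    rw [twistedSigma'_eq_chi5_mul h5, chi5, if_neg h, if_pos (by omega)]
    linarith

theorem four_mul_bBar5_of_even {n : ℕ} (h : 2 ∣ n) :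
    4 * bBar5 n = twistedSigma (n + 3) - twistedSigma' (n + 3) := by
  rw [four_mul_bBar5, (even_iff_two_dvd.2 h).neg_one_pow, one_mul, lambertCoeff_of_odd (by omega)]

theorem four_mul_bBar5_of_odd {n m : ℕ} (h : n + 3 = 2 * m) :
    4 * bBar5 n = -lambertCoeff (2 * m) := by
  have ho : Odd n := by rw [Nat.odd_iff]; omega
  rw [four_mul_bBar5, ho.neg_one_pow, h]
  ring

theorem bBar5_eq_zero_of_mod {n : ℕ} (h : (n + 3) % 20 ∈ ({1, 9, 11, 19, 2, 18} : Finset ℕ)) :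
    bBar5 n = 0 := by
  simp only [Finset.mem_insert, Finset.mem_singleton] at h
  by_cases h2 : 2 ∣ n
  · have := four_mul_bBar5_of_even h2
    rw [twistedSigma_sub_eq_zero (by omega)] at this
    omega
  · obtain ⟨m, hm⟩ : ∃ m, n + 3 = 2 * m := ⟨(n + 3) / 2, by omega⟩
    have := four_mul_bBar5_of_odd hm
    rw [lambertCoeff_two_mul_of_odd (by omega), twistedSigma_sub_eq_zero (by omega)] at this
    omega

theorem bBar5_pos_of_mod {n : ℕ}
    (h : (n + 3) % 20 ∈ ({3, 5, 7, 13, 15, 17, 6, 10, 14, 4, 16} : Finset ℕ)) : 0 < bBar5 n := by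
  simp only [Finset.mem_insert, Finset.mem_singleton] at h
  by_cases h2 : 2 ∣ n
  · have := four_mul_bBar5_of_even h2
    have := twistedSigma_sub_pos (n := n + 3) (by omega) (by omega)
    omega
  · obtain ⟨m, hm⟩ : ∃ m, n + 3 = 2 * m := ⟨(n + 3) / 2, by omega⟩
    have h4 := four_mul_bBar5_of_odd hm
    by_cases h2m : 2 ∣ m
    · obtain ⟨k, rfl⟩ := h2m
      have h5 : k % 5 = 1 ∨ k % 5 = 4 := by omega
      rw [lambertCoeff_four_mul (by omega) (by omega), chi5, if_pos h5] at h4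
      have := twistedSigma_pos (n := 2 * k) (by omega)
      omega
    · rw [lambertCoeff_two_mul_of_odd h2m] at h4
      have := twistedSigma_sub_pos (n := m) (by omega) (by omega)
      omega

/-- Here n + 3 = 4k with χ(k) = -1 and n is odd, so b̄₅(n) = -σ(k). -/
theorem bBar5_neg_of_mod {n : ℕ} (h : (n + 3) % 20 ∈ ({8, 12} : Finset ℕ)) : bBar5 n < 0 := by
  simp only [Finset.mem_insert, Finset.mem_singleton] at h
  obtain ⟨k, hk⟩ : ∃ k, n + 3 = 2 * (2 * k) := ⟨(n + 3) / 4, by omega⟩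
  have h4 := four_mul_bBar5_of_odd hk
  rw [lambertCoeff_four_mul (by omega) (by omega), chi5, if_neg (by omega), if_pos (by omega)] at h4
  have := twistedSigma_pos (n := k) (by omega)
  omega

/-! ### Lower densities of unions of residue classes -/

theorem lowerDensity_ge_of_mod {S : Set ℕ} (R : Finset ℕ) (hR : R ⊆ Finset.range 20)
    (h : ∀ n, (n + 3) % 20 ∈ R → n ∈ S) : (R.card : ℝ) / 20 ≤ lowerDensity S := by
  have hcount : ∀ N : ℕ, R.card * (N / 20) ≤ (S ∩ Set.Icc 1 N).ncard := fun N => by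
    -- The value lies in the block from 20k + 1 to 20k + 20 and is congruent to r - 3, so each
    -- complete block supplies one n with n + 3 ≡ r for every r in R.
    have hinj : Set.InjOn (fun p : ℕ × ℕ => 20 * p.2 + (16 + p.1) % 20 + 1)
        (R ×ˢ Finset.range (N / 20) : Finset (ℕ × ℕ)) := by
      rintro ⟨r, k⟩ h1 ⟨s, l⟩ h2 h3
      simp only [Finset.coe_product, Set.mem_prod, Finset.mem_coe] at h1 h2
      have h4 := Finset.mem_range.1 (hR h1.1)
      have h5 := Finset.mem_range.1 (hR h2.1)
      simp only at h3
      ext <;> simp only <;> omega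
    have hsub : (((R ×ˢ Finset.range (N / 20)).image fun p : ℕ × ℕ =>
        20 * p.2 + (16 + p.1) % 20 + 1 : Finset ℕ) : Set ℕ) ⊆ (S ∩ Set.Icc 1 N : Set ℕ) := by
      intro n hn
      simp only [Finset.coe_image, Set.mem_image, Finset.mem_coe, Finset.mem_product,
        Finset.mem_range] at hn
      obtain ⟨⟨r, k⟩, ⟨hr, hk⟩, rfl⟩ := hn
      have h4 := Finset.mem_range.1 (hR hr)
      simp only at hk ⊢
      refine ⟨h _ ?_, ?_, ?_⟩
      · convert hr using 1
        omega
      · omega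
      · omega
    have := Set.ncard_le_ncard hsub ((Set.finite_Icc 1 N).inter_of_right S)
    rwa [Set.ncard_coe_finset, Finset.card_image_of_injOn hinj, Finset.card_product,
      Finset.card_range] at this
  -- At most one incomplete block is lost, which costs at most |R|/N in the proportion.
  have hlim : Tendsto (fun N : ℕ => (R.card : ℝ) / 20 - R.card / (N : ℝ)) atTop
      (𝓝 ((R.card : ℝ) / 20)) := by
    simpa using (tendsto_const_div_atTop_nhds_zero_nat (R.card : ℝ)).const_sub ((R.card : ℝ) / 20)
  have hbdd : ∀ N : ℕ, ((S ∩ Set.Icc 1 N).ncard : ℝ) / N ≤ 1 := fun N => by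
    refine div_le_one_of_le₀ ?_ (Nat.cast_nonneg N)
    have := Set.ncard_le_ncard (Set.inter_subset_right : S ∩ Set.Icc 1 N ⊆ _) (Set.finite_Icc 1 N)
    rw [← Finset.coe_Icc, Set.ncard_coe_finset, Nat.card_Icc, Nat.add_sub_cancel] at this
    exact_mod_cast this
  rw [lowerDensity, ← hlim.liminf_eq]
  refine liminf_le_liminf ?_ hlim.isBoundedUnder_ge
    (isBoundedUnder_of ⟨1, hbdd⟩ : IsBoundedUnder (· ≤ ·) atTop _).isCoboundedUnder_ge
  filter_upwards [eventually_gt_atTop 0] with N hN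
  have hN' : (0 : ℝ) < N := by exact_mod_cast hN
  have h1 : (N : ℝ) ≤ 20 * (N / 20 : ℕ) + 20 := by
    have : N ≤ 20 * (N / 20) + 20 := by omega
    exact_mod_cast this
  have h2 : (R.card : ℝ) * (N / 20 : ℕ) ≤ ((S ∩ Set.Icc 1 N).ncard : ℝ) := by
    exact_mod_cast hcount N
  rw [le_div_iff₀ hN', sub_mul, div_mul_cancel₀ _ hN'.ne']
  nlinarith [(Nat.cast_nonneg R.card : (0 : ℝ) ≤ R.card)]

/-- The classes of n + 3 give 6/20, 11/20 and 2/20. The middle value, 55%, exceeds what is required,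
and the class of 0 is not used. -/
theorem corollary6 :
    (30 : ℝ) / 100 ≤ lowerDensity {n : ℕ | bBar5 n = 0} ∧
    (52 : ℝ) / 100 ≤ lowerDensity {n : ℕ | 0 < bBar5 n} ∧
    (10 : ℝ) / 100 ≤ lowerDensity {n : ℕ | bBar5 n < 0} := by
  refine ⟨?_, ?_, ?_⟩
  · refine le_trans ?_ (lowerDensity_ge_of_mod {1, 9, 11, 19, 2, 18} (by decide)
      fun n => bBar5_eq_zero_of_mod)
    norm_num
  · refine le_trans ?_ (lowerDensity_ge_of_mod {3, 5, 7, 13, 15, 17, 6, 10, 14, 4, 16} (by decide)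
      fun n => bBar5_pos_of_mod)
    norm_num
  · refine le_trans ?_ (lowerDensity_ge_of_mod {8, 12} (by decide) fun n => bBar5_neg_of_mod)
    norm_num
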